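/- **Conventions.** Let $\mathcal A$ be an additive category with filtered colimits. An object $X$ is finitely presented if $\mathrm{Hom}_{\mathcal A}(X,-)$ commutes with filtered colimits, and $\mathcal A$ is locally finitely presented if the full subcategory $\mathcal C=\mathrm{fp}\,\mathcal A$ of finitely presented objects is essentially small and every object of $\mathcal A$ is a filtered colimit of finitely presented objects. An exact structure $\mathcal E$ on $\mathcal C$ is an isomorphism-closed collection of kernel-cokernel pairs $X\xrightarrow{f}Y\xrightarrow{g}Z$ (the $f$ occurring are the $\mathcal E$-monomorphisms, the $g$ occurring the $\mathcal E$-epimorphisms) such that identities are $\mathcal E$-monomorphisms and $\mathcal E$-epimorphisms, both classes are closed under composition, push-outs of $\mathcal E$-monomorphisms along arbitrary morphisms exist and are $\mathcal E$-monomorphisms, and dually pull-backs of $\mathcal E$-epimorphisms exist and are $\mathcal E$-epimorphisms. Let $\mathrm{fp}(\mathcal C,\mathrm{Ab})$ be the category of functors $F\colon\mathcal C\to\mathrm{Ab}$ with $F\cong\mathrm{coker}\,\mathrm{Hom}_{\mathcal C}(f,-)$ for some morphism $f$ of $\mathcal C$, and for such $F$ let $\bar F\colon\mathcal A\to\mathrm{Ab}$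 be its unique extension commuting with filtered colimits. The purity category $\mathbf P(\mathcal A)$ is the category of left exact functors $\mathrm{fp}(\mathcal C,\mathrm{Ab})\to\mathrm{Ab}$, and $\mathrm{ev}\colon\mathcal A\to\mathbf P(\mathcal A)$ is given by $X\mapsto\bar X$, $\bar X(F)=\bar F(X)$. For an exact structure $\mathcal E$ on $\mathcal C$, let $\mathcal S_{\mathcal E}$ be the class of all $F\cong\mathrm{coker}\,\mathrm{Hom}_{\mathcal C}(f,-)$ with $f$ an $\mathcal E$-monomorphism, and let $\mathcal T_{\mathcal E}$ be the class of all filtered colimits in $\mathbf P(\mathcal A)$ of objects $\mathrm{Hom}(F,-)$ with $F\in\mathcal S_{\mathcal E}$. The relative purity category $\mathbf P_{\mathcal E}(\mathcal A)$ is the localisation of $\mathbf P(\mathcal A)$ with respect to $\mathcal T_{\mathcal E}$, that is, at the morphisms whose kernel and cokernel lie in $\mathcal T_{\mathcal E}$; let $q\colon\mathbf P(\mathcal A)\to\mathbf P_{\mathcal E}(\mathcal A)$ be the quotient functor. **Theorem.** Let $\mathcal A$ be a locally finitely presented category with products and let $\mathcal E$ be an exact structure on $\mathcal C=\mathrm{fp}\,\mathcal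 A$. Then $\mathbf P(\mathcal A)$ is a Grothendieck category, $\mathcal T_{\mathcal E}$ is a hereditary torsion class of finite type in $\mathbf P(\mathcal A)$ (a torsion class closed under subobjects whose torsion-free class is closed under filtered colimits), $\mathbf P_{\mathcal E}(\mathcal A)$ is a Grothendieck category, and the functor $$\mathrm{ev}_{\mathcal E}=q\circ\mathrm{ev}\colon\mathcal A\longrightarrow\mathbf P_{\mathcal E}(\mathcal A),\qquad X\mapsto\bar X,$$ is additive and fully faithful and commutes with filtered colimits and with (those existing) cokernels. Moreover, its essential image is closed under extensions: if $0\to X'\to X\to X''\to0$ is a short exact sequence in $\mathbf P_{\mathcal E}(\mathcal A)$ with $X'$ and $X''$ in the essential image of $\mathrm{ev}_{\mathcal E}$, then so is $X$. -/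

import Mathlib

open CategoryTheory CategoryTheory.Limits Opposite

universe w v u v₁ v₂ v₃ u₁ u₂ u₃

namespace RelativePurity

section Exact

variable {C : Type u} [Category.{v} C] [HasZeroMorphisms C]

/-- A composable pair `X ⟶ Y ⟶ Z` with zero composite is a kernel-cokernel pair if the first
morphism is a kernel of the second and the second is a cokernel of the first. -/
def IsKernelCokernelPair (S : ShortComplex C) : Prop :=
  Nonempty (IsLimit (KernelFork.ofι S.f S.zero)) ∧
    Nonempty (IsColimit (CokernelCofork.ofπ S.g S.zero))

/-- `f` is an admissible monomorphism for a collection of pairs: it is the first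
morphism of a pair of the collection. -/
def IsAdmissibleMono (E : ObjectProperty (ShortComplex C)) {X Y : C} (f : X ⟶ Y) : Prop :=
  ∃ (Z : C) (g : Y ⟶ Z) (h : f ≫ g = 0), E (ShortComplex.mk f g h)

/-- `g` is an admissible epimorphism for a collection of pairs: it is the second
morphism of a pair of the collection. -/
def IsAdmissibleEpi (E : ObjectProperty (ShortComplex C)) {Y Z : C} (g : Y ⟶ Z) : Prop :=
  ∃ (X : C) (f : X ⟶ Y) (h : f ≫ g = 0), E (ShortComplex.mk f g h)

variable (C) in
/-- An exact structure (in the sense of Quillen, with Bühler's axioms): an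
isomorphism-closed collection of kernel-cokernel pairs satisfying
[E0], [E0ᵒᵖ], [E1], [E1ᵒᵖ], [E2], [E2ᵒᵖ]. -/
structure ExactStructure where
  /-- the conflations of the exact structure -/
  conflation : ObjectProperty (ShortComplex C)
  isKernelCokernelPair : ∀ S, conflation S → IsKernelCokernelPair S
  of_iso : ∀ S T : ShortComplex C, Nonempty (S ≅ T) → conflation S → conflation T
  mono_id : ∀ X : C, IsAdmissibleMono conflation (𝟙 X)
  epi_id : ∀ X : C, IsAdmissibleEpi conflation (𝟙 X)
  mono_comp : ∀ {X Y Z : C} (f : X ⟶ Y) (g : Y ⟶ Z),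
    IsAdmissibleMono conflation f → IsAdmissibleMono conflation g →
      IsAdmissibleMono conflation (f ≫ g)
  epi_comp : ∀ {X Y Z : C} (f : X ⟶ Y) (g : Y ⟶ Z),
    IsAdmissibleEpi conflation f → IsAdmissibleEpi conflation g →
      IsAdmissibleEpi conflation (f ≫ g)
  pushout_mono : ∀ {X Y X' : C} (f : X ⟶ Y) (h : X ⟶ X'), IsAdmissibleMono conflation f →
    ∃ (P : C) (i : Y ⟶ P) (f' : X' ⟶ P), IsPushout f h i f' ∧ IsAdmissibleMono conflation f'
  pullback_epi : ∀ {Y Z Z' : C} (g : Y ⟶ Z) (h : Z' ⟶ Z), IsAdmissibleEpi conflation g →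
    ∃ (P : C) (p : P ⟶ Y) (g' : P ⟶ Z'), IsPullback p g' g h ∧ IsAdmissibleEpi conflation g'

/-- The torsion-free class of a class of objects `T`: all `Y` such that every morphism
from an object of `T` to `Y` is zero. -/
def torsionFree (T : ObjectProperty C) : ObjectProperty C :=
  fun Y ↦ ∀ (X : C), T X → ∀ f : X ⟶ Y, f = 0

/-- `T` is a hereditary torsion class of finite type: `(T, torsionFree T)` is a torsion pair
(every object is an extension of a torsion-free object by a torsion object), `T` is closed
under subobjects, and the torsion-free class is closed under (`w`-small) filtered colimits. -/
structure IsHereditaryTorsionClassOfFiniteType (T : ObjectProperty C) : Prop where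
  isClosedUnderIsomorphisms : T.IsClosedUnderIsomorphisms
  exists_shortExact : ∀ X : C, ∃ (X' X'' : C) (i : X' ⟶ X) (p : X ⟶ X'') (h : i ≫ p = 0),
    (ShortComplex.mk i p h).ShortExact ∧ T X' ∧ torsionFree T X''
  isClosedUnderSubobjects : T.IsClosedUnderSubobjects
  isClosedUnderFilteredColimits : ∀ (J : Type w) [SmallCategory J] [IsFiltered J],
    (torsionFree T).IsClosedUnderColimitsOfShape J

/-- The morphisms whose kernel and cokernel belong to `T`. Inverting them in an abelian
category with a hereditary torsion class `T` gives the localisation (quotient category)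
with respect to `T`. -/
def isoModTorsion (T : ObjectProperty C) : MorphismProperty C :=
  fun _ _ f ↦ (∃ k : KernelFork f, Nonempty (IsLimit k) ∧ T k.pt) ∧
    ∃ c : CokernelCofork f, Nonempty (IsColimit c) ∧ T c.pt

end Exact

section Kan

variable {C : Type u₁} [Category.{v₁} C] {D : Type u₂} [Category.{v₂} D] {H : Type u₃}
  [Category.{v₃} H] (L : C ⥤ D) (X : D) [∀ X : D, HasColimitsOfShape (CostructuredArrow L X) H]

/-- The value at `X` of the left Kan extension of `G` along `L` is the colimit of the `G(Y)`
over all `L(Y) ⟶ X`. -/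
noncomputable def lanObjIso (G : C ⥤ H) :
    (L.lan.obj G).obj X ≅ colimit (CostructuredArrow.proj L X ⋙ G) :=
  IsColimit.coconePointUniqueUpToIso
    (L.isPointwiseLeftKanExtensionLeftKanExtensionUnit G X) (colimit.isColimit _)

lemma ι_lanObjIso (G : C ⥤ H) (T : CostructuredArrow L X) :
    (L.lanUnit.app G).app T.left ≫ (L.lan.obj G).map T.hom ≫ (lanObjIso L X G).hom =
      colimit.ι (CostructuredArrow.proj L X ⋙ G) T := by
  have h := IsColimit.comp_coconePointUniqueUpToIso_hom
    (L.isPointwiseLeftKanExtensionLeftKanExtensionUnit G X)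
    (colimit.isColimit (CostructuredArrow.proj L X ⋙ G)) T
  exact (Category.assoc _ _ _).symm.trans h

/-- Naturality of `lanObjIso` in the functor. -/
noncomputable def lanEvaluationIso :
    L.lan ⋙ (evaluation D H).obj X ≅
      (Functor.whiskeringLeft _ _ H).obj (CostructuredArrow.proj L X) ⋙ colim :=
  NatIso.ofComponents (fun G ↦ lanObjIso L X G) (fun {G₁ G₂} φ ↦ by
    apply (L.isPointwiseLeftKanExtensionLeftKanExtensionUnit G₁ X).hom_ext
    intro T
    have h₁ := ι_lanObjIso L X G₁ T
    have h₂ := ι_lanObjIso L X G₂ T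
    have h₃ : (L.lanUnit.app G₁).app T.left ≫ (L.lan.map φ).app (L.obj T.left) =
      φ.app T.left ≫ (L.lanUnit.app G₂).app T.left :=
        (congr_app (L.lanUnit.naturality φ) T.left).symm
    have h₄ : (L.lan.obj G₁).map T.hom ≫ (L.lan.map φ).app X =
      (L.lan.map φ).app (L.obj T.left) ≫ (L.lan.obj G₂).map T.hom := (L.lan.map φ).naturality T.hom
    change ((L.lanUnit.app G₁).app T.left ≫ (L.lan.obj G₁).map T.hom) ≫ (L.lan.map φ).app X ≫
        (lanObjIso L X G₂).hom = ((L.lanUnit.app G₁).app T.left ≫ (L.lan.obj G₁).map T.hom) ≫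
        (lanObjIso L X G₁).hom ≫ colimMap (Functor.whiskerLeft (CostructuredArrow.proj L X) φ)
    rw [Category.assoc, Category.assoc, reassoc_of% h₄, reassoc_of% h₃, h₂, reassoc_of% h₁]
    exact (ι_colimMap (Functor.whiskerLeft (CostructuredArrow.proj L X) φ) T).symm)

end Kan

section Purity

/-- The full subcategory `fp A` of finitely presented objects: those `X` such that `Hom(X, -)`
commutes with (`w`-small) filtered colimits. -/
abbrev Fp (A : Type u) [Category.{w} A] : Type u :=
  (ObjectProperty.isFinitelyPresentable.{w} A).FullSubcategory

/-- Finitely presented functors `C ⥤ Ab`: those isomorphic to the cokernel of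
`Hom(f, -) : Hom(Y, -) ⟶ Hom(X, -)` for some morphism `f : X ⟶ Y`.
Such functors are automatically additive. -/
def isFpFunctor (C : Type u) [Category.{w} C] [Preadditive C] :
    ObjectProperty (C ⥤ AddCommGrpCat.{w}) :=
  fun F ↦ ∃ (X Y : C) (f : X ⟶ Y), Nonempty (F ≅ cokernel (preadditiveCoyoneda.map f.op))

/-- The category `fp(C, Ab)` of finitely presented functors `C ⥤ Ab`. -/
abbrev FpFunctor (C : Type u) [Category.{w} C] [Preadditive C] :=
  (isFpFunctor C).FullSubcategory

section

variable {C : Type u} [Category.{w} C] [Preadditive C]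

lemma isFpFunctor_coyoneda (X : C) : isFpFunctor C (preadditiveCoyoneda.obj (op X)) := by
  refine ⟨X, X, 0, ⟨?_⟩⟩
  have h : preadditiveCoyoneda.map (0 : X ⟶ X).op = 0 := by
    ext Y g
    exact zero_comp (f := (g : X ⟶ Y))
  exact cokernelZeroIsoTarget.symm ≪≫ cokernelIsoOfEq h.symm

lemma isFpFunctor.additive {F : C ⥤ AddCommGrpCat.{w}} (hF : isFpFunctor C F) : F.Additive := by
  obtain ⟨X, Y, f, ⟨e⟩⟩ := hF
  refine ⟨fun {Z Z' g g'} ↦ ?_⟩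
  let p : preadditiveCoyoneda.obj (op X) ⟶ F := cokernel.π (preadditiveCoyoneda.map f.op) ≫ e.inv
  have hp : Epi p := by dsimp only [p]; infer_instance
  have : Epi (p.app Z) := inferInstance
  rw [← cancel_epi (p.app Z)]
  simp only [← p.naturality, Preadditive.comp_add, Functor.map_add, Preadditive.add_comp]

/-- The Yoneda lemma: evaluation at `X` is corepresented by `Hom(X, -)` on `fp(C, Ab)`. -/
def corepresentableByEvaluation (X : C) :
    ((isFpFunctor C).ι ⋙ (evaluation C AddCommGrpCat.{w}).obj X ⋙
      forget AddCommGrpCat.{w}).CorepresentableBy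
        (⟨_, isFpFunctor_coyoneda X⟩ : FpFunctor C) where
  homEquiv {F} :=
    { toFun := fun φ ↦ φ.hom.app X (𝟙 X)
      invFun := fun x ↦ ⟨
        { app := fun Y ↦ AddCommGrpCat.ofHom
            { toFun := fun g ↦ F.obj.map g x
              map_zero' := by
                have := isFpFunctor.additive F.property
                exact congr($(F.obj.map_zero X Y) x)
              map_add' := fun g g' ↦ by
                have := isFpFunctor.additive F.property
                exact congr($(F.obj.map_add (f := (g : X ⟶ Y)) (g := g')) x) }
          naturality := fun Y Z h ↦ by
            ext g
            exact congr($(F.obj.map_comp (g : X ⟶ Y) h) x) }⟩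
      left_inv := fun φ ↦ by
        ext Y g
        have h := congr($(φ.hom.naturality (g : X ⟶ Y)) (𝟙 X))
        exact h.symm.trans congr(φ.hom.app Y $(Category.id_comp (g : X ⟶ Y)))
      right_inv := fun x ↦ congr($(F.obj.map_id X) x) }
  homEquiv_comp _ _ := rfl

lemma preservesLimits_ι_evaluation (X : C) :
    PreservesLimitsOfSize.{0, 0} ((isFpFunctor C).ι ⋙ (evaluation C AddCommGrpCat.{w}).obj X) := by
  have : (((isFpFunctor C).ι ⋙ (evaluation C AddCommGrpCat.{w}).obj X) ⋙
      forget AddCommGrpCat.{w}).IsCorepresentable :=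
    (corepresentableByEvaluation X).isCorepresentable
  exact preservesLimits_of_reflects_of_preserves _ (forget AddCommGrpCat.{w})

lemma preservesFiniteLimits_ι : PreservesFiniteLimits (isFpFunctor C).ι := by
  constructor
  intro J _ _
  exact preservesLimitsOfShape_of_evaluation _ _ fun X ↦
    (preservesLimits_ι_evaluation X).preservesLimitsOfShape

end

variable (A : Type u) [Category.{w} A] [Preadditive A]

/-- The purity category `P(A)`: left exact functors `fp(fp A, Ab) ⥤ Ab`. -/
abbrev PurityCategory := FpFunctor (Fp A) ⥤ₗ AddCommGrpCat.{w}

section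

variable [IsFinitelyAccessibleCategory.{w} A]

instance hasColimitsOfShape_costructuredArrow (X : A) :
    HasColimitsOfShape (CostructuredArrow (ObjectProperty.isFinitelyPresentable.{w} A).ι X)
      AddCommGrpCat.{w} :=
  hasColimitsOfShape_of_essentiallySmall.{w} _ _

instance hasExactColimitsOfShape_costructuredArrow (X : A) :
    HasExactColimitsOfShape (CostructuredArrow (ObjectProperty.isFinitelyPresentable.{w} A).ι X)
      AddCommGrpCat.{w} := by
  let e := (equivSmallModel.{w}
      (CostructuredArrow (ObjectProperty.isFinitelyPresentable.{w} A).ι X))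
  have := IsFiltered.of_equivalence e
  exact HasExactColimitsOfShape.of_domain_equivalence _ e.symm

instance hasLeftKanExtension_fp (F : Fp A ⥤ AddCommGrpCat.{w}) :
    (ObjectProperty.isFinitelyPresentable.{w} A).ι.HasLeftKanExtension F := by
  have : (ObjectProperty.isFinitelyPresentable.{w} A).ι.HasPointwiseLeftKanExtension F :=
    fun X ↦ inferInstance
  infer_instance

/-- `X ↦ (F ↦ F̄(X))`, where `F̄ : A ⥤ Ab` is the left Kan extension along `fp A ⥤ A` of
`F : fp A ⥤ Ab`; for finitely accessible `A` this is the unique extension of `F` to `A`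
that commutes with filtered colimits. -/
noncomputable def extendedEvaluation : A ⥤ FpFunctor (Fp A) ⥤ AddCommGrpCat.{w} :=
  ((isFpFunctor (Fp A)).ι ⋙ (ObjectProperty.isFinitelyPresentable.{w} A).ι.lan).flip

lemma preservesFiniteLimits_extendedEvaluation (X : A) :
    PreservesFiniteLimits ((extendedEvaluation A).obj X) := by
  have := preservesFiniteLimits_ι (C := Fp A)
  exact preservesFiniteLimits_of_natIso (Functor.isoWhiskerLeft (isFpFunctor (Fp A)).ι
    (lanEvaluationIso (ObjectProperty.isFinitelyPresentable.{w} A).ι X)).symm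

/-- The functor `ev : A ⥤ P(A)`, `X ↦ X̄` with `X̄(F) = F̄(X)`. -/
noncomputable def ev : A ⥤ PurityCategory A :=
  ObjectProperty.lift _ (extendedEvaluation A) (preservesFiniteLimits_extendedEvaluation A)

end

variable {A} (E : ExactStructure (Fp A))

/-- The class `S_E` in `fp(fp A, Ab)`: functors isomorphic to the cokernel of `Hom(f, -)`
for some admissible monomorphism `f` of the exact structure `E`. -/
def serreClass : ObjectProperty (FpFunctor (Fp A)) :=
  fun F ↦ ∃ (X Y : Fp A) (f : X ⟶ Y), IsAdmissibleMono E.conflation f ∧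
    Nonempty (F.obj ≅ cokernel (preadditiveCoyoneda.map f.op))

/-- The class `S_E` viewed inside `P(A)` through `F ↦ Hom(F, -)`: left exact functors
corepresented by an object of `S_E`. -/
def corepresentedBySerreClass : ObjectProperty (PurityCategory A) :=
  fun L ↦ ∃ F : FpFunctor (Fp A), serreClass E F ∧
    Nonempty ((L.obj ⋙ CategoryTheory.forget AddCommGrpCat.{w}).CorepresentableBy F)

/-- The class `T_E` in `P(A)` determined by `E`: (`w`-small) filtered colimits of objects `Hom(F, -)`
with `F` in `S_E`. -/
def torsionClass : ObjectProperty (PurityCategory A) :=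
  ObjectProperty.ind.{w} (corepresentedBySerreClass E)

/-- The relative purity category `P_E(A)`: the localisation of `P(A)` with respect to `T_E`. -/
abbrev RelativePurityCategory := (isoModTorsion (torsionClass E)).Localization

/-- The quotient functor `q : P(A) ⥤ P_E(A)`. -/
abbrev quotientFunctor : PurityCategory A ⥤ RelativePurityCategory E :=
  (isoModTorsion (torsionClass E)).Q

/-- The functor `ev_E : A ⥤ P_E(A)`, `X ↦ X̄`: the composite of `ev` and the quotient functor. -/
noncomputable def evRelative [IsFinitelyAccessibleCategory.{w} A] : A ⥤ RelativePurityCategory E :=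
  ev A ⋙ quotientFunctor E

end Purity

end RelativePurity

/-! Let `K` be a small model of the opposite of fp(C, Ab), where C = fp A. Products in A give C weak
cokernels (`hasWeakCokernels_fp`), and this makes `K` abelian. The functor `J : C ⥤ K`, X ↦ Hom(X,
-), is fully faithful with injective values, and every object of `K` embeds into a value. Left exact
functors are ind-objects, so P(A) is equivalent to Ind K (`leftExactToInd`); on C the functor ev is
`J` followed by the Yoneda embedding.

Under this equivalence S_E becomes the class S of kernels of `J.map f`, with f an admissible
monomorphism. An object M lies in S exactly when each morphism M ⟶ J X is annihilated by `J.map g`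
for some admissible monomorphism g out of X (`kernels_iff`), so S is a Serre class. Let `L : K ⥤ K'`
be the quotient by S. Its extension Ind K ⥤ Ind K' is exact, has a fully faithful right adjoint
given by restriction, and has as kernel the filtered colimits of objects of S
(`kernel_indExtension`), which is T_E. Hence T_E is the kernel of an exact localisation with target
Ind K', and P_E(A) is equivalent to Ind K'.

An admissible monomorphism is the kernel of its cokernel in C. Therefore objects J X have no nonzero
morphisms to S and lift along epimorphisms with kernel in S (`eq_zero_of_kernels`,
`exists_lift_of_epi`). So `J ⋙ L` is fully faithful, and it sends conflations to short exact
sequences. Given an extension G of LJV by LJX, the monomorphism LJX ⟶ G extends to the image of an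
admissible monomorphism X ⟶ Y with cokernel W. Thus G is the pullback of LJY ⟶ LJW along a morphism
coming from V ⟶ W, and it is the image of the pullback formed in C (`exists_iso_of_shortExact`).

Finite presentability carries these facts from C to A. Injective objects of Ind K' lie in the image
(`exists_mono_to_image`), so every object embeds into the image; this forces additivity and
preservation of cokernels. An extension in Ind K' is approximated by extensions of finitely
presented objects (`essImage_of_shortExact`). -/

open scoped ZeroObject

namespace RelativePurity

/-! ### Functors out of finitely accessible categories, controlled on finitely presentable objects.
-/

section FinitelyAccessible

variable {A : Type u₁} [Category.{w} A] {B : Type u₂} [Category.{w} B]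

attribute [local instance] Cardinal.fact_isRegular_aleph0

/-- In a finitely accessible category every object is a filtered colimit of finitely
presentable objects. -/
lemma exists_presentation_isFinitelyPresentable [IsFinitelyAccessibleCategory.{w} A] (X : A) :
    ∃ (J : Type w) (_ : SmallCategory J) (_ : IsFiltered J) (p : ColimitPresentation J X),
      ∀ j, IsFinitelyPresentable.{w} (p.diag.obj j) := by
  obtain ⟨J, _, hJ, ⟨p⟩⟩ := (isCardinalFilteredGenerator_isCardinalPresentable
    A Cardinal.aleph0.{w}).exists_colimitsOfShape X
  rw [isCardinalFiltered_aleph0_iff] at hJ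
  exact ⟨J, inferInstance, hJ, p.toColimitPresentation, p.prop_diag_obj⟩

instance hasColimitsOfShape_of_isFinitelyAccessible [IsFinitelyAccessibleCategory.{w} A]
    (J : Type w) [SmallCategory J] [IsFiltered J] : HasColimitsOfShape J A :=
  (HasCardinalFilteredColimits_iff_hasFilteredColimitsOfSize.{w}.1
    (inferInstanceAs (HasCardinalFilteredColimits.{w} A Cardinal.aleph0))).1 J

lemma isFinitelyPresentable_biprod [HasZeroMorphisms B] [HasBinaryBiproducts B] (X Y : B)
    [IsFinitelyPresentable.{w} X] [IsFinitelyPresentable.{w} Y] :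
    IsFinitelyPresentable.{w} (X ⊞ Y) := by
  have (k : Discrete WalkingPair) :
      IsCardinalPresentable ((pair X Y).obj k) Cardinal.aleph0.{w} := by
    obtain ⟨_ | _⟩ := k
    · exact inferInstanceAs (IsFinitelyPresentable.{w} X)
    · exact inferInstanceAs (IsFinitelyPresentable.{w} Y)
  exact isCardinalPresentable_of_isColimit _ (BinaryBiproduct.isColimit X Y) Cardinal.aleph0.{w}
    (by
      rw [hasCardinalLT_aleph0_iff]
      infer_instance)

lemma isFinitelyPresentable_of_isPushout {R X Y P : B} {f : R ⟶ X} {g : R ⟶ Y} {i : X ⟶ P}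
    {j : Y ⟶ P} (sq : IsPushout f g i j) [IsFinitelyPresentable.{w} R]
    [IsFinitelyPresentable.{w} X] [IsFinitelyPresentable.{w} Y] : IsFinitelyPresentable.{w} P := by
  have (k : WalkingSpan) : IsCardinalPresentable ((span f g).obj k) Cardinal.aleph0.{w} := by
    rcases k with _ | _ | _
    · exact inferInstanceAs (IsFinitelyPresentable.{w} R)
    · exact inferInstanceAs (IsFinitelyPresentable.{w} X)
    · exact inferInstanceAs (IsFinitelyPresentable.{w} Y)
  exact isCardinalPresentable_of_isColimit _ sq.isColimit Cardinal.aleph0.{w}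
    (by
      rw [hasCardinalLT_aleph0_iff]
      infer_instance)

section Extension

variable (Φ : A ⥤ B) [PreservesFilteredColimitsOfSize.{w, w} Φ] [IsFinitelyAccessibleCategory.{w} A]
  (hfp : ∀ X : A, IsFinitelyPresentable.{w} X → IsFinitelyPresentable.{w} (Φ.obj X))
  (hff : ∀ X Y : A, IsFinitelyPresentable.{w} X → IsFinitelyPresentable.{w} Y →
    Function.Bijective (Φ.map : (X ⟶ Y) → _))

include hfp hff

/-- Both Hom(X, -) and Hom(ΦX, -) commute with a filtered colimit presenting `Y`, which reduces the
claim to finitely presentable targets. -/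
lemma bijective_map_of_isFinitelyPresentable (X Y : A) (hX : IsFinitelyPresentable.{w} X) :
    Function.Bijective (Φ.map : (X ⟶ Y) → _) := by
  obtain ⟨J, _, _, p, hp⟩ := exists_presentation_isFinitelyPresentable.{w} Y
  have := hfp X hX
  have hΦ := isColimitOfPreserves Φ p.isColimit
  constructor
  · intro f g hfg
    obtain ⟨i, f', rfl⟩ := IsFinitelyPresentable.exists_hom_of_isColimit p.isColimit f
    obtain ⟨j, g', rfl⟩ := IsFinitelyPresentable.exists_hom_of_isColimit p.isColimit g
    obtain ⟨k, a, b, h⟩ := IsFinitelyPresentable.exists_eq_of_isColimit hΦ (Φ.map f') (Φ.map g')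
      (by simpa using hfg)
    dsimp at h
    rw [← Φ.map_comp, ← Φ.map_comp] at h
    have h' := (hff _ _ hX (hp k)).1 h
    have e₁ := p.ι.naturality a
    have e₂ := p.ι.naturality b
    dsimp at e₁ e₂ ⊢
    rw [Category.comp_id] at e₁ e₂
    rw [← e₁, ← e₂, reassoc_of% h']
  · intro g
    obtain ⟨j, g', rfl⟩ := IsFinitelyPresentable.exists_hom_of_isColimit hΦ g
    obtain ⟨f, rfl⟩ := (hff _ _ hX (hp j)).2 g'
    exact ⟨f ≫ p.ι.app j, by simp⟩

lemma faithful_of_isFinitelyPresentable : Φ.Faithful where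
  map_injective {X Y} f g hfg := by
    obtain ⟨J, _, _, p, hp⟩ := exists_presentation_isFinitelyPresentable.{w} X
    refine p.isColimit.hom_ext fun j ↦
      (bijective_map_of_isFinitelyPresentable Φ hfp hff _ _ (hp j)).1 ?_
    simp [hfg]

/-- The restrictions of `g` to the stages of a presentation of `X` lift uniquely; uniqueness makes
the lifts a cocone. -/
lemma full_of_isFinitelyPresentable : Φ.Full where
  map_surjective {X Y} g := by
    obtain ⟨J, _, _, p, hp⟩ := exists_presentation_isFinitelyPresentable.{w} X
    have H := fun j ↦ bijective_map_of_isFinitelyPresentable Φ hfp hff _ Y (hp j)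
    choose f hf using fun j ↦ (H j).2 (Φ.map (p.ι.app j) ≫ g)
    let c : Cocone p.diag := ⟨Y,
      { app := f
        naturality := fun i j a ↦ by
          apply (H i).1
          have := p.ι.naturality a
          dsimp at this ⊢
          rw [Category.comp_id] at this
          rw [Category.comp_id, Φ.map_comp, hf, hf, ← Φ.map_comp_assoc, this] }⟩
    refine ⟨p.isColimit.desc c, (isColimitOfPreserves Φ p.isColimit).hom_ext fun j ↦ ?_⟩
    have := p.isColimit.fac c j
    dsimp at this ⊢
    rw [← Φ.map_comp, this, hf]

end Extension

/-- The essential image of the restriction of `Φ` to finitely presentable objects. -/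
def fpImage (Φ : A ⥤ B) : ObjectProperty B :=
  fun Y ↦ ∃ X : A, IsFinitelyPresentable.{w} X ∧ Nonempty (Φ.obj X ≅ Y)

/-- A filtered diagram in the image of a fully faithful functor lifts to the source, so the
essential image is closed under filtered colimits. -/
lemma essImage_eq_ind_fpImage (Φ : A ⥤ B) [PreservesFilteredColimitsOfSize.{w, w} Φ]
    [IsFinitelyAccessibleCategory.{w} A] [Φ.Full] [Φ.Faithful] :
    Φ.essImage = ObjectProperty.ind.{w} (fpImage Φ) := by
  refine le_antisymm ?_ ?_
  · rintro Y ⟨X, ⟨e⟩⟩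
    obtain ⟨J, _, _, p, hp⟩ := exists_presentation_isFinitelyPresentable.{w} X
    exact ⟨J, inferInstance, inferInstance, (p.map Φ).ofIso e, fun j ↦ ⟨_, hp j, ⟨Iso.refl _⟩⟩⟩
  · rintro Y ⟨J, _, _, p, hp⟩
    have H (j : J) : Φ.essImage (p.diag.obj j) := by
      obtain ⟨X, _, hX⟩ := hp j
      exact ⟨X, hX⟩
    have : PreservesColimitsOfShape J Φ :=
      PreservesFilteredColimitsOfSize.preserves_filtered_colimits J
    exact ObjectProperty.prop_of_isColimit Φ.essImage p.isColimit H

/-- A fully faithful functor such that every object of the target embeds into an object of the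
image preserves all existing colimits. -/
lemma preservesColimit_of_mono_to_image [Abelian B] (Φ : A ⥤ B) [Φ.Full] [Φ.Faithful]
    (h : ∀ Y : B, ∃ (X : A) (i : Y ⟶ Φ.obj X), Mono i)
    {J : Type u₃} [Category.{v₃} J] (K : J ⥤ A) : PreservesColimit K Φ where
  preserves {c} hc := by
    refine ⟨IsColimit.ofExistsUnique fun s ↦ ?_⟩
    -- Embedding `s.pt` and then `cokernel i` copresents `s.pt` by objects of the image. The
    -- universal property of `hc`, which only tests against objects of `A`, then determines
    -- morphisms into `s.pt`.
    obtain ⟨I, i, _⟩ := h s.pt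
    obtain ⟨I', i', _⟩ := h (cokernel i)
    let t : Cocone K := ⟨I,
      { app := fun j ↦ Φ.preimage (s.ι.app j ≫ i)
        naturality := fun j k a ↦ Φ.map_injective (by
          have := s.w a
          dsimp at this ⊢
          simp [reassoc_of% this]) }⟩
    have fac (j) : c.ι.app j ≫ hc.desc t = Φ.preimage (s.ι.app j ≫ i) := hc.fac t j
    have hz : hc.desc t ≫ Φ.preimage (cokernel.π i ≫ i') = hc.desc t ≫ Φ.preimage 0 :=
      hc.hom_ext fun j ↦ Φ.map_injective (by
        rw [reassoc_of% (fac j), reassoc_of% (fac j)]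
        simp)
    have hz' : Φ.map (hc.desc t) ≫ cokernel.π i = 0 := by
      rw [← cancel_mono i', Category.assoc, zero_comp]
      simpa using congr(Φ.map $hz)
    refine ⟨Abelian.monoLift i _ hz', fun j ↦ ?_, fun m hm ↦ ?_⟩
    · rw [← cancel_mono i, Category.assoc, Abelian.monoLift_comp]
      dsimp
      rw [← Φ.map_comp, fac, Functor.map_preimage]
    · rw [← cancel_mono i, Abelian.monoLift_comp]
      obtain ⟨n, hn⟩ := Φ.map_surjective (m ≫ i)
      rw [← hn]
      congr 1
      refine hc.hom_ext fun j ↦ Φ.map_injective ?_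
      have := hm j
      dsimp at this
      rw [fac, Φ.map_comp, hn, reassoc_of% this, Functor.map_preimage]

lemma additive_of_mono_to_image [Preadditive A] [HasBinaryBiproducts A] [Abelian B] (Φ : A ⥤ B)
    [Φ.Full] [Φ.Faithful] (h : ∀ Y : B, ∃ (X : A) (i : Y ⟶ Φ.obj X), Mono i) : Φ.Additive := by
  have (X Y : A) : PreservesColimit (pair X Y) Φ := preservesColimit_of_mono_to_image Φ h _
  have (X Y : A) : PreservesBinaryBiproduct X Y Φ :=
    preservesBinaryBiproduct_of_preservesBinaryCoproduct Φ
  have : PreservesBinaryBiproducts Φ := ⟨fun {X Y} ↦ this X Y⟩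
  exact Functor.additive_of_preservesBinaryBiproducts Φ

section Abelian

variable [Abelian B]

/-- An epimorphism onto a finitely presentable object restricts to an epimorphism from a
finitely presentable object. -/
lemma exists_epi_of_isFinitelyPresentable [IsFinitelyAccessibleCategory.{w} B] {M Y : B}
    (p : M ⟶ Y) [Epi p] [IsFinitelyPresentable.{w} Y] :
    ∃ (G : B) (t : G ⟶ M), IsFinitelyPresentable.{w} G ∧ Epi (t ≫ p) := by
  obtain ⟨J, _, _, c, hc⟩ := exists_presentation_isFinitelyPresentable.{w} M
  have : Nonempty J := IsFiltered.nonempty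
  -- The diagram `cokernel ψ` consists of quotients of `Y`, and since `p` is epi the maps from `Y`
  -- vanish in its colimit. As `Y` is finitely presentable, such a map already vanishes at a stage
  -- `k`, where `ψ.app k` is therefore epi.
  let ψ : c.diag ⟶ (Functor.const J).obj Y := c.ι ≫ (Functor.const J).map p
  let Q := cokernel ψ
  have hQ (i j : J) (a : i ⟶ j) : (cokernel.π ψ).app i ≫ Q.map a = (cokernel.π ψ).app j := by
    have := (cokernel.π ψ).naturality a
    dsimp at this
    rw [Category.id_comp] at this
    exact this.symm
  have h0 (i : J) : c.ι.app i ≫ p ≫ (cokernel.π ψ).app i = 0 := by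
    have : ψ.app i ≫ (cokernel.π ψ).app i = 0 := congr_app (cokernel.condition ψ) i
    simpa [ψ] using this
  have h1 (i j : J) : (cokernel.π ψ).app i ≫ colimit.ι Q i =
      (cokernel.π ψ).app j ≫ colimit.ι Q j := by
    rw [← colimit.w Q (IsFiltered.leftToMax i j), ← colimit.w Q (IsFiltered.rightToMax i j),
      reassoc_of% (hQ i _ (IsFiltered.leftToMax i j)),
      reassoc_of% (hQ j _ (IsFiltered.rightToMax i j))]
  have h2 (i : J) : (cokernel.π ψ).app i ≫ colimit.ι Q i = 0 := by
    rw [← cancel_epi p, comp_zero]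
    refine c.isColimit.hom_ext fun j ↦ ?_
    dsimp
    rw [h1 i j, reassoc_of% (h0 j), zero_comp, comp_zero]
  obtain ⟨i⟩ := this
  obtain ⟨k, a, b, hk⟩ := IsFinitelyPresentable.exists_eq_of_isColimit (colimit.isColimit Q)
    (X := Y) (i := i) (j := i) ((cokernel.π ψ).app i) (0 : Y ⟶ Q.obj i) (by simpa using h2 i)
  rw [hQ, zero_comp] at hk
  refine ⟨c.diag.obj k, c.ι.app k, hc k, ?_⟩
  have : IsColimit (CokernelCofork.ofπ ((cokernel.π ψ).app k) (by
      have : ψ.app k ≫ (cokernel.π ψ).app k = 0 := congr_app (cokernel.condition ψ) k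
      exact this) : CokernelCofork (ψ.app k)) :=
    CokernelCofork.mapIsColimit _ (cokernelIsCokernel ψ) ((evaluation J B).obj k)
  have h3 : Epi (ψ.app k) := by
    refine Preadditive.epi_of_isZero_cokernel' _ this ?_
    have : Epi ((cokernel.π ψ).app k) := inferInstance
    exact IsZero.of_epi_eq_zero ((cokernel.π ψ).app k) hk
  simpa [ψ] using h3

/-- The cokernel of a pushout of a monomorphism. -/
lemma shortExact_of_isPushout {R G V P W : B} {i : R ⟶ G} {c : R ⟶ V} {a : G ⟶ P} {b : V ⟶ P}
    (sq : IsPushout i c a b) {p : G ⟶ W} (w : i ≫ p = 0)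
    (h : (ShortComplex.mk i p w).ShortExact) {p' : P ⟶ W} (w' : b ≫ p' = 0) (hp : a ≫ p' = p) :
    (ShortComplex.mk b p' w').ShortExact := by
  have := h.mono_f
  have := h.epi_g
  dsimp at *
  have hb : Mono b := (MorphismProperty.monomorphisms B).of_isPushout sq.flip ‹_›
  have hp' : Epi p' := by
    have : Epi (a ≫ p') := by rwa [hp]
    exact epi_of_epi a p'
  refine ShortComplex.ShortExact.mk' (ShortComplex.exact_of_g_is_cokernel _ ?_) hb hp'
  refine CokernelCofork.IsColimit.ofπ _ _
    (fun {T} k hk ↦ h.exact.desc (a ≫ k) ?_) (fun {T} k hk ↦ ?_) (fun {T} k hk m hm ↦ ?_)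
  · dsimp
    rw [sq.w_assoc, hk, comp_zero]
  · refine sq.hom_ext ?_ ?_
    · rw [reassoc_of% hp]
      exact h.exact.g_desc _ _
    · exact ((reassoc_of% w') _).trans (zero_comp.trans hk.symm)
  · rw [← cancel_epi p]
    refine Eq.trans ?_ (h.exact.g_desc _ _).symm
    dsimp at hm ⊢
    rw [← hm, ← Category.assoc, hp]

end Abelian

/-- It suffices to factor each morphism from a finitely presentable `Z` to the middle term through
an object of `fpImage Φ`. Its composite to the right term factors through some `W` in `fpImage Φ`;
the extension is pulled back to `W` and covered by a finitely presentable G. The kernel of G ⟶ W is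
finitely presentable, so its morphism to the left term factors through some `V` in `fpImage Φ`.
Pushing out along it gives an extension of `W` by `V`, to which `hext` applies. -/
theorem essImage_of_shortExact [Abelian B] [IsFinitelyAccessibleCategory.{w} A]
    [IsFinitelyAccessibleCategory.{w} B] (Φ : A ⥤ B) [PreservesFilteredColimitsOfSize.{w, w} Φ]
    [Φ.Full] [Φ.Faithful]
    (hfp : ∀ X : A, IsFinitelyPresentable.{w} X → IsFinitelyPresentable.{w} (Φ.obj X))
    (hker : ∀ {G W : B} (p : G ⟶ W) [Epi p], IsFinitelyPresentable.{w} G →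
      IsFinitelyPresentable.{w} W → IsFinitelyPresentable.{w} (kernel p))
    (hext : ∀ S : ShortComplex B, S.ShortExact → IsFinitelyPresentable.{w} S.X₂ →
      fpImage.{w} Φ S.X₁ → fpImage.{w} Φ S.X₃ → fpImage.{w} Φ S.X₂)
    (S : ShortComplex B) (hS : S.ShortExact) (h₁ : Φ.essImage S.X₁) (h₃ : Φ.essImage S.X₃) :
    Φ.essImage S.X₂ := by
  have hle : fpImage.{w} Φ ≤ ObjectProperty.isFinitelyPresentable.{w} B := by
    rintro Y ⟨X, hX, ⟨e⟩⟩
    have := hfp X hX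
    exact isCardinalPresentable_of_iso e _
  rw [essImage_eq_ind_fpImage] at h₁ h₃ ⊢
  rw [ObjectProperty.ind_iff_exists hle] at h₁ h₃ ⊢
  intro Z g hZ
  have := hS.mono_f
  have := hS.epi_g
  obtain ⟨W, a, b, hab, hW⟩ := h₃ (g ≫ S.g)
  have hW' : IsFinitelyPresentable.{w} W := hle _ hW
  obtain ⟨G₀, t, hG₀, ht⟩ := exists_epi_of_isFinitelyPresentable (pullback.snd S.g b)
  -- The summand `G₀` makes the morphism to `W` epi; the summand `Z` makes `g` factor through the
  -- result.
  have hG : IsFinitelyPresentable.{w} (G₀ ⊞ Z) := isFinitelyPresentable_biprod _ _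
  let z : Z ⟶ pullback S.g b := pullback.lift g a hab.symm
  let u : G₀ ⊞ Z ⟶ pullback S.g b := biprod.desc t z
  let p := u ≫ pullback.snd S.g b
  have hp : Epi p := by
    have : biprod.inl ≫ p = t ≫ pullback.snd S.g b := by simp [p, u]
    have : Epi (biprod.inl ≫ p) := by rwa [this]
    exact epi_of_epi biprod.inl p
  have hR := hker p hG hW'
  have hr : (kernel.ι p ≫ u ≫ pullback.fst S.g b) ≫ S.g = 0 := by
    simp only [Category.assoc]
    rw [pullback.condition, ← Category.assoc u, kernel.condition_assoc, zero_comp]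
  obtain ⟨V, c, d, hcd, hV⟩ := h₁ (hS.exact.lift _ hr)
  have hV' : IsFinitelyPresentable.{w} V := hle _ hV
  have hcd' : c ≫ d ≫ S.f = kernel.ι p ≫ u ≫ pullback.fst S.g b := by
    rw [← Category.assoc, hcd, hS.exact.lift_f]
  have sq := IsPushout.of_hasPushout (kernel.ι p) c
  let p' : pushout (kernel.ι p) c ⟶ W := pushout.desc p 0 (by simp)
  have hse := shortExact_of_isPushout sq (kernel.condition p)
    (ShortComplex.ShortExact.mk' (ShortComplex.exact_kernel p) inferInstance hp)
    (p' := p') (pushout.inr_desc _ _ _) (pushout.inl_desc _ _ _)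
  refine ⟨_, biprod.inr ≫ pushout.inl _ _,
    pushout.desc (u ≫ pullback.fst S.g b) (d ≫ S.f) hcd'.symm, ?_,
    hext _ hse (isFinitelyPresentable_of_isPushout sq) hV hW⟩
  rw [Category.assoc, pushout.inl_desc, biprod.inr_desc_assoc, pullback.lift_fst]

end FinitelyAccessible

/-! ### Ind-objects of a small category and their finitely presentable objects. -/

section Ind

attribute [local instance] Cardinal.fact_isRegular_aleph0

variable {K : Type w} [SmallCategory K]

/-- The Yoneda lemma for ind-objects. -/
noncomputable def indYonedaEquiv {G : K} {N : Ind K} :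
    (Ind.yoneda.obj G ⟶ N) ≃ ((Ind.inclusion K).obj N).obj (op G) :=
  (Ind.inclusion.fullyFaithful (C := K)).homEquiv.trans
    (((Ind.yonedaCompInclusion (C := K)).app G).homFromEquiv.trans yonedaEquiv)

lemma indYonedaEquiv_comp {G : K} {N N' : Ind K} (f : Ind.yoneda.obj G ⟶ N) (g : N ⟶ N') :
    indYonedaEquiv (f ≫ g) = ((Ind.inclusion K).map g).app (op G) (indYonedaEquiv f) := by
  simp [indYonedaEquiv, Ind.inclusion.fullyFaithful, Functor.FullyFaithful.homEquiv,
    yonedaEquiv_comp, Iso.homFromEquiv]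

lemma indYonedaEquiv_naturality {G G' : K} {N : Ind K} (a : G' ⟶ G)
    (f : Ind.yoneda.obj G ⟶ N) :
    indYonedaEquiv (Ind.yoneda.map a ≫ f) =
      ((Ind.inclusion K).obj N).map a.op (indYonedaEquiv f) := by
  have := (Ind.yonedaCompInclusion (C := K)).inv.naturality_assoc a ((Ind.inclusion K).map f)
  dsimp at this
  simp only [indYonedaEquiv, Functor.FullyFaithful.homEquiv, Iso.homFromEquiv,
    yonedaEquiv_naturality, Equiv.trans_apply, Equiv.coe_fn_mk, Functor.map_comp, Iso.app_inv]
  rw [← this]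

/-- Morphisms from the ind-object represented by `G` are computed by evaluation at `G`. -/
noncomputable def coyonedaIndYonedaIso (G : K) :
    coyoneda.obj (op (Ind.yoneda.obj G)) ≅
      Ind.inclusion K ⋙ (evaluation Kᵒᵖ (Type w)).obj (op G) :=
  NatIso.ofComponents (fun N ↦ (indYonedaEquiv (N := N)).toIso)
    (fun g ↦ by ext f; exact indYonedaEquiv_comp f g)

instance isFinitelyPresentable_indYoneda (G : K) :
    IsFinitelyPresentable.{w} (Ind.yoneda.obj G : Ind K) := by
  rw [isFinitelyPresentable_iff_preservesFilteredColimitsOfSize]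
  constructor
  intro J _ _
  exact preservesColimitsOfShape_of_natIso (coyonedaIndYonedaIso G).symm

lemma exists_presentation_indYoneda (N : Ind K) :
    ∃ (J : Type w) (_ : SmallCategory J) (_ : IsFiltered J) (F : J ⥤ K)
      (c : Cocone (F ⋙ Ind.yoneda)) (_ : IsColimit c), c.pt = N :=
  ⟨_, inferInstance, inferInstance, N.presentation.F,
    ⟨N, (colimit.cocone _).ι ≫ (Functor.const _).map (Ind.colimitPresentationCompYoneda N).hom⟩,
    IsColimit.ofIsoColimit (colimit.isColimit _)
      (Cocone.ext (Ind.colimitPresentationCompYoneda N)), rfl⟩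

instance isFinitelyAccessibleCategory_ind : IsFinitelyAccessibleCategory.{w} (Ind K) where
  hasColimitsOfShape J _ hJ := by
    rw [isCardinalFiltered_aleph0_iff] at hJ
    infer_instance
  exists_generator := by
    refine ⟨ObjectProperty.ofObj (Ind.yoneda (C := K)).obj, inferInstance, ?_, fun N ↦ ?_⟩
    · rintro _ ⟨G⟩
      exact isFinitelyPresentable_indYoneda G
    · obtain ⟨J, _, hJ, F, c, hc, rfl⟩ := exists_presentation_indYoneda N
      refine ⟨J, inferInstance, ?_, ⟨{ diag := _, ι := c.ι, isColimit := hc, prop_diag_obj := ?_ }⟩⟩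
      · rwa [isCardinalFiltered_aleph0_iff]
      · exact fun j ↦ ⟨_⟩

variable [Abelian K]

/-- The identity of `N` factors through a stage of a presentation, so `N` is a retract of a
representable. The idempotent lives in `K` and splits there because `K` is abelian. -/
lemma exists_iso_indYoneda_of_isFinitelyPresentable (N : Ind K) [IsFinitelyPresentable.{w} N] :
    ∃ G : K, Nonempty (Ind.yoneda.obj G ≅ N) := by
  obtain ⟨J, _, hJ, F, c, hc, rfl⟩ := exists_presentation_indYoneda N
  obtain ⟨j, s, hs⟩ := IsFinitelyPresentable.exists_hom_of_isColimit hc (𝟙 c.pt)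
  obtain ⟨e, he⟩ := (Ind.yoneda (C := K)).map_surjective (c.ι.app j ≫ s)
  have hee : e ≫ e = e := (Ind.yoneda (C := K)).map_injective (by
    simp [he, reassoc_of% hs])
  obtain ⟨Y, i, p, hip, hpi⟩ := IsIdempotentComplete.idempotents_split _ e hee
  refine ⟨Y, ⟨⟨Ind.yoneda.map i ≫ c.ι.app j, s ≫ Ind.yoneda.map p, ?_, ?_⟩⟩⟩
  · rw [Category.assoc, ← reassoc_of% he, ← hpi]
    simp only [Functor.map_comp, Category.assoc]
    simp only [← Functor.map_comp, hip, Category.comp_id]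
    exact CategoryTheory.Functor.map_id _ _
  · rw [Category.assoc, ← Functor.map_comp_assoc, hpi, he, Category.assoc, hs,
      reassoc_of% hs]

lemma isFinitelyPresentable_kernel {G W : Ind K} (p : G ⟶ W) (hG : IsFinitelyPresentable.{w} G)
    (hW : IsFinitelyPresentable.{w} W) : IsFinitelyPresentable.{w} (kernel p) := by
  obtain ⟨G', ⟨e⟩⟩ := exists_iso_indYoneda_of_isFinitelyPresentable G
  obtain ⟨W', ⟨e'⟩⟩ := exists_iso_indYoneda_of_isFinitelyPresentable W
  obtain ⟨f, hf⟩ := (Ind.yoneda (C := K)).map_surjective (e.hom ≫ p ≫ e'.inv)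
  let i : Ind.yoneda.obj (kernel f) ≅ kernel p :=
    PreservesKernel.iso Ind.yoneda f ≪≫ kernel.mapIso (Ind.yoneda.map f) p e e' (by simp [hf])
  exact isCardinalPresentable_of_iso i _

end Ind

/-! ### Extension of an exact quotient functor to ind-objects. -/

section IndLocalization

attribute [local instance] Cardinal.fact_isRegular_aleph0

variable {K K' : Type w} [SmallCategory K] [SmallCategory K'] [Abelian K] [Abelian K']
  (L : K ⥤ K') [PreservesFiniteColimits L]

/-- The opposite of a right exact functor, as a left exact functor. -/
def opLeftExact : Kᵒᵖ ⥤ₗ K'ᵒᵖ := ⟨L.op, preservesFiniteLimits_op L⟩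

/-- Restriction of ind-objects, regarded as left exact functors, along an exact functor. -/
noncomputable def indRestriction : Ind K' ⥤ Ind K :=
  (Ind.leftExactFunctorEquivalence K').functor ⋙
    (LeftExactFunctor.whiskeringLeft _ _ _).obj (opLeftExact L) ⋙
    (Ind.leftExactFunctorEquivalence K).inverse

noncomputable def indRestrictionCompInclusion :
    indRestriction L ⋙ Ind.inclusion K ≅
      Ind.inclusion K' ⋙ (Functor.whiskeringLeft _ _ (Type w)).obj L.op :=
  Functor.isoWhiskerLeft ((Ind.leftExactFunctorEquivalence K').functor ⋙
    (LeftExactFunctor.whiskeringLeft _ _ _).obj (opLeftExact L))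
    (Functor.isoWhiskerRight (Ind.leftExactFunctorEquivalence K).counitIso (ObjectProperty.ι _))

noncomputable def indRestrictionEquiv {G : K} {N : Ind K'} :
    (Ind.yoneda.obj G ⟶ (indRestriction L).obj N) ≃ (Ind.yoneda.obj (L.obj G) ⟶ N) :=
  indYonedaEquiv.trans ((((indRestrictionCompInclusion L).app N).app (op G)).toEquiv.trans
    indYonedaEquiv.symm)

lemma indRestrictionEquiv_comp {G : K} {N N' : Ind K'}
    (f : Ind.yoneda.obj G ⟶ (indRestriction L).obj N) (g : N ⟶ N') :
    indRestrictionEquiv L (f ≫ (indRestriction L).map g) = indRestrictionEquiv L f ≫ g := by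
  apply indYonedaEquiv.injective
  rw [indYonedaEquiv_comp]
  simp only [indRestrictionEquiv, Equiv.trans_apply, Equiv.apply_symm_apply]
  rw [indYonedaEquiv_comp]
  have := congr_app ((indRestrictionCompInclusion L).hom.naturality g) (op G)
  exact congr($this (indYonedaEquiv f))

lemma indRestrictionEquiv_naturality {G G' : K} {N : Ind K'} (a : G' ⟶ G)
    (f : Ind.yoneda.obj G ⟶ (indRestriction L).obj N) :
    indRestrictionEquiv L (Ind.yoneda.map a ≫ f) =
      Ind.yoneda.map (L.map a) ≫ indRestrictionEquiv L f := by
  apply indYonedaEquiv.injective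
  rw [indYonedaEquiv_naturality]
  simp only [indRestrictionEquiv, Equiv.trans_apply, Equiv.apply_symm_apply]
  rw [indYonedaEquiv_naturality]
  have := ((indRestrictionCompInclusion L).hom.app N).naturality a.op
  exact congr($this (indYonedaEquiv f))

noncomputable def corepresentableByIndRestriction (G : K) :
    (indRestriction L ⋙ coyoneda.obj (op (Ind.yoneda.obj G))).CorepresentableBy
      (Ind.yoneda.obj (L.obj G)) where
  homEquiv := (indRestrictionEquiv L).symm
  homEquiv_comp g f := by
    apply (indRestrictionEquiv L).injective
    rw [Equiv.apply_symm_apply]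
    refine Eq.trans ?_ (indRestrictionEquiv_comp L _ _).symm
    rw [Equiv.apply_symm_apply]

/-- The left adjoint is defined on representables, where it is `L`, and the objects on which it is
defined are closed under colimits. -/
instance isRightAdjoint_indRestriction : (indRestriction L).IsRightAdjoint := by
  refine Functor.isRightAdjoint_of_leftAdjointObjIsDefined_eq_top (top_unique fun N _ ↦ ?_)
  obtain ⟨J, _, hJ, F, c, hc, rfl⟩ := exists_presentation_indYoneda N
  exact Functor.leftAdjointObjIsDefined_of_isColimit hc
    fun j ↦ (corepresentableByIndRestriction L (F.obj j)).isCorepresentable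

/-- The functor `Ind K ⥤ Ind K'` induced by an exact functor `K ⥤ K'`. -/
noncomputable def indExtension : Ind K ⥤ Ind K' := (indRestriction L).leftAdjoint

noncomputable def indAdjunction : indExtension L ⊣ indRestriction L :=
  Adjunction.ofIsRightAdjoint _

instance : (indExtension L).IsLeftAdjoint := (indAdjunction L).isLeftAdjoint

noncomputable def indExtensionObjIso (G : K) :
    (indExtension L).obj (Ind.yoneda.obj G) ≅ Ind.yoneda.obj (L.obj G) :=
  ((indAdjunction L).corepresentableBy _).uniqueUpToIso (corepresentableByIndRestriction L G)

lemma indExtensionObjIso_inv_comp {G : K} {N : Ind K'}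
    (f : (indExtension L).obj (Ind.yoneda.obj G) ⟶ N) :
    (indExtensionObjIso L G).inv ≫ f =
      indRestrictionEquiv L ((indAdjunction L).homEquiv _ _ f) := by
  have : (indExtensionObjIso L G).inv =
      indRestrictionEquiv L ((indAdjunction L).homEquiv _ _ (𝟙 _)) := by
    simp [indExtensionObjIso, corepresentableByIndRestriction]
    rfl
  rw [this, ← indRestrictionEquiv_comp, ← Adjunction.homEquiv_naturality_right, Category.id_comp]

/-- `indExtension L` extends `L`. -/
noncomputable def yonedaCompIndExtension :
    Ind.yoneda ⋙ indExtension L ≅ L ⋙ Ind.yoneda :=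
  (NatIso.ofComponents (fun G ↦ (indExtensionObjIso L G).symm) (fun {G G'} a ↦ by
    dsimp
    rw [← Category.comp_id (indExtensionObjIso L G').inv, indExtensionObjIso_inv_comp,
      indExtensionObjIso_inv_comp, ← indRestrictionEquiv_naturality,
      ← Adjunction.homEquiv_naturality_left, Category.comp_id])).symm

instance : (indExtension L).Additive :=
  have : PreservesBinaryBiproducts (indExtension L) :=
    preservesBinaryBiproducts_of_preservesBinaryCoproducts _
  Functor.additive_of_preservesBinaryBiproducts _

/-- `indExtension L` acts on a filtered formal colimit by applying `L` to the diagram. -/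
noncomputable def indLimCompIndExtension (I : Type w) [SmallCategory I] [IsFiltered I] :
    Ind.lim I ⋙ indExtension L ≅ (Functor.whiskeringRight I K K').obj L ⋙ Ind.lim I :=
  Functor.isoWhiskerLeft ((Functor.whiskeringRight _ _ _).obj Ind.yoneda)
      (preservesColimitNatIso (indExtension L)) ≪≫
    Functor.isoWhiskerRight
      ((Functor.whiskeringRight I _ _).mapIso (yonedaCompIndExtension L)) colim

/-- Every morphism of ind-objects is, up to isomorphism, the formal colimit of a natural
transformation of filtered diagrams in `K`. Its kernel is computed stagewise, and `L` preserves the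
kernels at each stage. -/
instance preservesFiniteLimits_indExtension [PreservesFiniteLimits L] :
    PreservesFiniteLimits (indExtension L) := by
  refine ((Functor.preservesFiniteLimits_tfae _).out 2 3).mp (fun M N f ↦ ?_)
  obtain ⟨I, _, _, F, G, φ, ⟨e⟩⟩ := Ind.exists_nonempty_arrow_mk_iso_ind_lim (f := f)
  have : PreservesLimit (parallelPair φ 0) (Ind.lim I ⋙ indExtension L) :=
    preservesLimit_of_natIso _ (indLimCompIndExtension L I).symm
  have : PreservesLimit (parallelPair ((Ind.lim I).map φ) 0) (indExtension L) :=
    preservesLimit_of_preserves_limit_cone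
      (KernelFork.isLimitMapConeEquiv _ _
        (isLimitOfPreserves (Ind.lim I) (kernelIsKernel φ)))
          ((KernelFork.isLimitMapConeEquiv _ (indExtension L)).symm
            (KernelFork.isLimitMapConeEquiv _ (Ind.lim I ⋙ indExtension L)
              (isLimitOfPreserves (Ind.lim I ⋙ indExtension L) (kernelIsKernel φ))))
  exact preservesLimit_of_iso_diagram _
    (show parallelPair ((Ind.lim I).map φ) 0 ≅ parallelPair f 0 from
      parallelPair.ext (Arrow.leftFunc.mapIso e.symm) (Arrow.rightFunc.mapIso e.symm)
        (Arrow.w e.inv).symm (zero_comp.trans comp_zero.symm))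

variable (S : ObjectProperty K) [S.IsSerreClass] [L.IsLocalization S.isoModSerre]

include S in
-- On underlying presheaves this is precomposition with a localization functor, which is fully
-- faithful.
lemma fullyFaithful_indRestriction : Nonempty (indRestriction L).FullyFaithful := by
  have h := Localization.fullyFaithfulWhiskeringLeft L.op S.isoModSerre.op (Type w)
  exact ⟨Functor.FullyFaithful.ofCompFaithful (G := Ind.inclusion K)
    ((Ind.inclusion.fullyFaithful.comp h).ofIso (indRestrictionCompInclusion L).symm)⟩

/-- The ind-objects represented by objects of `S`. -/
def indYonedaImage : ObjectProperty (Ind K) :=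
  fun N ↦ ∃ G : K, S G ∧ Nonempty (Ind.yoneda.obj G ≅ N)

-- If the extension kills `N`, a morphism from a representable to `N` becomes, at some stage, a
-- morphism `f` of `K` with L f = 0. It factors through the image of `f`, which lies in `S`. The
-- converse holds because the extension preserves colimits.
open ObjectProperty.SerreClassLocalization in
lemma kernel_indExtension :
    (indExtension L).kernel = ObjectProperty.ind.{w} (indYonedaImage S) := by
  have : PreservesBinaryBiproducts L := preservesBinaryBiproducts_of_preservesBinaryCoproducts _
  have := Functor.additive_of_preservesBinaryBiproducts L
  have hL {G : K} : IsZero ((indExtension L).obj (Ind.yoneda.obj G)) ↔ S G := by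
    rw [← isZero_obj_iff L S]
    refine ((yonedaCompIndExtension L).app G).isZero_iff.trans
      ⟨fun h ↦ ?_, fun h ↦ Ind.yoneda.map_isZero h⟩
    rw [IsZero.iff_id_eq_zero]
    exact (Ind.yoneda (C := K')).map_injective (h.eq_of_src _ _)
  have hle : indYonedaImage S ≤ ObjectProperty.isFinitelyPresentable.{w} (Ind K) := by
    rintro N ⟨G, _, ⟨e⟩⟩
    exact isCardinalPresentable_of_iso e _
  refine le_antisymm (fun N hN ↦ ?_) ?_
  · replace hN : IsZero ((indExtension L).obj N) := hN
    rw [ObjectProperty.ind_iff_exists hle]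
    intro Z g hZ
    obtain ⟨F, ⟨e⟩⟩ := exists_iso_indYoneda_of_isFinitelyPresentable Z
    obtain ⟨J, _, hJ, D, c, hc, rfl⟩ := exists_presentation_indYoneda N
    obtain ⟨j, a, ha⟩ := IsFinitelyPresentable.exists_hom_of_isColimit hc g
    have hc' := isColimitOfPreserves (indExtension L) hc
    have : IsFinitelyPresentable.{w} ((indExtension L).obj (Ind.yoneda.obj F)) :=
      have := isFinitelyPresentable_indYoneda (L.obj F)
      isCardinalPresentable_of_iso (X := Ind.yoneda.obj (L.obj F))
        ((yonedaCompIndExtension L).app F).symm _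
    -- The colimit of the extended diagram is zero, so the morphism from a finitely presentable
    -- object dies at a later stage `k`.
    obtain ⟨k, b, b', hk⟩ := IsFinitelyPresentable.exists_eq_of_isColimit hc' (i := j) (j := j)
      ((indExtension L).map (e.hom ≫ a)) 0 (hN.eq_of_tgt _ _)
    obtain ⟨f, hf⟩ := (Ind.yoneda (C := K)).map_surjective (e.hom ≫ a ≫ (D ⋙ Ind.yoneda).map b)
    have hf0 : (indExtension L).map (Ind.yoneda.map f) = 0 := by
      rw [hf, ← Category.assoc, Functor.map_comp]
      simpa using hk
    have hS : S (Abelian.image f) := by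
      rw [← map_eq_zero_iff L S]
      apply (Ind.yoneda (C := K')).map_injective
      have := (yonedaCompIndExtension L).inv.naturality f
      dsimp at this
      rw [hf0, comp_zero] at this
      rw [Functor.map_zero, ← cancel_mono ((yonedaCompIndExtension L).inv.app _), this, zero_comp]
    refine ⟨_, e.inv ≫ Ind.yoneda.map (Abelian.factorThruImage f),
      Ind.yoneda.map (Abelian.image.ι f) ≫ c.ι.app k, ?_, _, hS, ⟨Iso.refl _⟩⟩
    rw [Category.assoc, ← Functor.map_comp_assoc, Abelian.image.fac, hf]
    have := c.w b
    dsimp at this ⊢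
    simp [← ha, this]
  · rintro N ⟨J, _, _, p, hp⟩
    change IsZero _
    rw [IsZero.iff_id_eq_zero]
    refine (isColimitOfPreserves (indExtension L) p.isColimit).hom_ext fun j ↦ ?_
    obtain ⟨G, hG, ⟨e⟩⟩ := hp j
    exact (((indExtension L).mapIso e).isZero_iff.1 (hL.2 hG)).eq_of_src _ _

end IndLocalization

/-! ### Elementary properties of exact structures. -/

namespace ExactStructure

variable {C : Type u₁} [Category.{v₁} C] [Preadditive C] (E : ExactStructure C)

lemma isAdmissibleMono_comp_iso {X Y Y' : C} {f : X ⟶ Y} (hf : IsAdmissibleMono E.conflation f)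
    (e : Y ≅ Y') : IsAdmissibleMono E.conflation (f ≫ e.hom) := by
  obtain ⟨Z, g, h, hS⟩ := hf
  exact ⟨Z, e.inv ≫ g, by simp [h], E.of_iso (ShortComplex.mk f g h) _
    ⟨ShortComplex.isoMk (Iso.refl X) e (Iso.refl Z) (by simp) (by simp)⟩ hS⟩

lemma isAdmissibleMono_of_isPushout {X Y X' P : C} {f : X ⟶ Y} {h : X ⟶ X'} {i : Y ⟶ P}
    {f' : X' ⟶ P} (sq : IsPushout f h i f') (hf : IsAdmissibleMono E.conflation f) :
    IsAdmissibleMono E.conflation f' := by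
  obtain ⟨P', i', f'', sq', hf''⟩ := E.pushout_mono f h hf
  simpa using E.isAdmissibleMono_comp_iso hf'' (sq'.isoIsPushout _ _ sq)

/-- The kernel of the admissible epimorphism `𝟙 X` is the zero morphism into `X`, and `biprod.inr`
is its pushout along 0 ⟶ Y. -/
lemma isAdmissibleMono_biprod_inr (X Y : C) [HasBinaryBiproduct X Y] :
    IsAdmissibleMono E.conflation (biprod.inr : Y ⟶ X ⊞ Y) := by
  obtain ⟨Z, z, hz, hS⟩ := E.epi_id X
  obtain ⟨⟨hk⟩, _⟩ := E.isKernelCokernelPair _ hS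
  have hZ : IsZero Z := by
    have : z = 0 := by simpa using hz
    rw [IsZero.iff_id_eq_zero]
    exact Fork.IsLimit.hom_ext hk (by simp [this])
  have sq : IsPushout z (0 : Z ⟶ Y) (biprod.inl : X ⟶ X ⊞ Y) biprod.inr := by
    convert IsPushout.of_is_coproduct' (BinaryBiproduct.isColimit X Y) hZ.isInitial using 1
    all_goals exact hZ.eq_of_src _ _
  exact E.isAdmissibleMono_of_isPushout sq ⟨X, 𝟙 X, hz, hS⟩

lemma isPushout_biprod_map {X Y : C} (g : X ⟶ Y) (Z : C) [HasBinaryBiproduct Z X]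
    [HasBinaryBiproduct Z Y] :
    IsPushout g (biprod.inr : X ⟶ Z ⊞ X) (biprod.inr : Y ⟶ Z ⊞ Y) (biprod.map (𝟙 Z) g) :=
  ⟨⟨by simp⟩, ⟨PushoutCocone.IsColimit.mk _ (fun s ↦ biprod.desc (biprod.inl ≫ s.inr) s.inl)
    (fun s ↦ by simp)
    (fun s ↦ by
      have := s.condition
      ext <;> simp [this])
    (fun s m h₁ h₂ ↦ by
      ext
      · simp [← h₂]
      · simp [← h₁])⟩⟩

/-- The morphism is `biprod.inr`, followed by the shear automorphism of `Z ⊞ X` with entry `b`,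
followed by 1 ⊕ g, which is a pushout of `g`. -/
lemma isAdmissibleMono_biprod_lift {X Y Z : C} [HasBinaryBiproducts C] {g : X ⟶ Y}
    (hg : IsAdmissibleMono E.conflation g) (b : X ⟶ Z) :
    IsAdmissibleMono E.conflation (biprod.lift b g) := by
  let e : Z ⊞ X ≅ Z ⊞ X :=
    { hom := biprod.desc biprod.inl (biprod.lift b (𝟙 X))
      inv := biprod.desc biprod.inl (biprod.lift (-b) (𝟙 X))
      hom_inv_id := by ext <;> simp
      inv_hom_id := by ext <;> simp }
  have : biprod.lift b g = (biprod.inr ≫ e.hom) ≫ biprod.map (𝟙 Z) g := by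
    ext <;> simp [e]
  rw [this]
  exact E.mono_comp _ _ (E.isAdmissibleMono_comp_iso (E.isAdmissibleMono_biprod_inr Z X) e)
    (E.isAdmissibleMono_of_isPushout (isPushout_biprod_map g Z) hg)

/-- A pullback of `g` has the same kernel `X`, so the conflation through `g'` is isomorphic to one
with left term `X`. -/
lemma conflation_of_isPullback {X Y Z Z' P : C} {f : X ⟶ Y} {g : Y ⟶ Z} {h : f ≫ g = 0}
    (hS : E.conflation (ShortComplex.mk f g h)) {p : P ⟶ Y} {g' : P ⟶ Z'} {v : Z' ⟶ Z}
    (sq : IsPullback p g' g v) (hg' : IsAdmissibleEpi E.conflation g') :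
    ∃ (x : X ⟶ P) (h' : x ≫ g' = 0), x ≫ p = f ∧ E.conflation (ShortComplex.mk x g' h') := by
  obtain ⟨X₀, x₀, h₀, hS₀⟩ := hg'
  obtain ⟨⟨hk⟩, _⟩ := E.isKernelCokernelPair _ hS
  obtain ⟨⟨hk₀⟩, _⟩ := E.isKernelCokernelPair _ hS₀
  dsimp at hk hk₀
  let x : X ⟶ P := sq.lift f 0 (by simp [h])
  have hx : x ≫ g' = 0 := sq.lift_snd _ _ _
  have hxp : x ≫ p = f := sq.lift_fst _ _ _
  obtain ⟨a, ha⟩ := KernelFork.IsLimit.lift' hk₀ x hx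
  obtain ⟨b, hb⟩ := KernelFork.IsLimit.lift' hk (x₀ ≫ p) (by
    rw [Category.assoc, sq.w, reassoc_of% h₀, zero_comp])
  dsimp at ha hb
  have hab : a ≫ b = 𝟙 X := Fork.IsLimit.hom_ext hk (by
    dsimp
    rw [Category.assoc, hb, reassoc_of% ha, hxp, Category.id_comp])
  have hba : b ≫ a = 𝟙 X₀ := Fork.IsLimit.hom_ext hk₀ (by
    dsimp
    rw [Category.assoc, ha, Category.id_comp]
    apply sq.hom_ext
    · rw [Category.assoc, hxp, hb]
    · rw [Category.assoc, hx, h₀, comp_zero])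
  exact ⟨x, hx, hxp, E.of_iso (ShortComplex.mk x₀ g' h₀) _
    ⟨ShortComplex.isoMk ⟨b, a, hba, hab⟩ (Iso.refl P) (Iso.refl Z')
    (by
      dsimp
      rw [← ha, reassoc_of% hba, Category.comp_id]) (by simp)⟩ hS₀⟩

end ExactStructure

/-! ### The Serre class attached to an exact structure, and its quotient. -/

section

/-- The kernel of a pullback of an epimorphism. -/
lemma shortExact_of_isPullback {B : Type u} [Category.{v} B] [Abelian B] {X Y W V P : B}
    {a : P ⟶ Y} {b : P ⟶ V} {p : Y ⟶ W} {c : V ⟶ W} (sq : IsPullback a b p c) {i : X ⟶ Y}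
    (w : i ≫ p = 0) (h : (ShortComplex.mk i p w).ShortExact) {i' : X ⟶ P} (w' : i' ≫ b = 0)
    (hi : i' ≫ a = i) : (ShortComplex.mk i' b w').ShortExact := by
  have := h.mono_f
  have := h.epi_g
  dsimp at *
  have hb : Epi b := (MorphismProperty.epimorphisms B).of_isPullback sq ‹_›
  have hi' : Mono i' := by
    have : Mono (i' ≫ a) := by rwa [hi]
    exact mono_of_mono i' a
  refine ShortComplex.ShortExact.mk' (ShortComplex.exact_of_f_is_kernel _ ?_) hi' hb
  refine KernelFork.IsLimit.ofι _ _
    (fun {T} k hk ↦ h.exact.lift (k ≫ a) ?_) (fun {T} k hk ↦ ?_) (fun {T} k hk m hm ↦ ?_)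
  · dsimp
    rw [Category.assoc, sq.w, reassoc_of% hk, zero_comp]
  · refine sq.hom_ext ?_ ?_
    · dsimp
      rw [Category.assoc, hi]
      exact h.exact.lift_f _ _
    · dsimp
      rw [Category.assoc, w', comp_zero, hk]
  · rw [← cancel_mono i]
    refine Eq.trans ?_ (h.exact.lift_f _ _).symm
    dsimp at hm ⊢
    rw [← hm, Category.assoc, hi]

/-- A functor to an abelian category all of whose values are injective and such that every object
embeds into a value. -/
class IsInjectivelyCogenerating {C : Type u₁} [Category.{v₁} C] {K : Type u₂} [Category.{v₂} K]
    (J : C ⥤ K) : Prop where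
  injective (X : C) : Injective (J.obj X)
  exists_mono (M : K) : ∃ (X : C) (i : M ⟶ J.obj X), Mono i

attribute [instance] IsInjectivelyCogenerating.injective

namespace ExactStructure

variable {C : Type u₁} [Category.{v₁} C] [Preadditive C] (E : ExactStructure C)
  {K : Type u₂} [Category.{v₂} K] [Abelian K] (J : C ⥤ K)

/-- The kernels of the images of admissible monomorphisms. -/
def kernels : ObjectProperty K := fun M ↦
  ∃ (X Y : C) (f : X ⟶ Y), IsAdmissibleMono E.conflation f ∧ Nonempty (M ≅ kernel (J.map f))

variable [J.Full]

/-- By injectivity `a` extends along M ⟶ J A to `J.map x`; the pushout of `f` along `x` annihilates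
it. -/
lemma exists_of_kernels [IsInjectivelyCogenerating J] {M : K} (hM : E.kernels J M)
    {X : C} (a : M ⟶ J.obj X) :
    ∃ (Y : C) (g : X ⟶ Y), IsAdmissibleMono E.conflation g ∧ a ≫ J.map g = 0 := by
  obtain ⟨A, B, f, hf, ⟨e⟩⟩ := hM
  let i := e.hom ≫ kernel.ι (J.map f)
  obtain ⟨x, hx⟩ := J.map_surjective (Injective.factorThru a i)
  obtain ⟨P, b, f', sq, hf'⟩ := E.pushout_mono f x hf
  refine ⟨P, f', hf', ?_⟩
  rw [← Injective.comp_factorThru a i, Category.assoc, ← hx, ← J.map_comp, ← sq.w, J.map_comp]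
  simp [i]

variable [J.Additive]

/-- Embedding `cokernel i` into some J B gives b : X ⟶ B such that `M` is the kernel of `J.map b`.
Since `g` also kills `M`, the admissible monomorphism (b, g) has kernel exactly `M`. -/
lemma kernels_of_mono [IsInjectivelyCogenerating J] [HasBinaryBiproducts C] {M : K} {X Y : C}
    (i : M ⟶ J.obj X) [Mono i]
    (g : X ⟶ Y) (hg : IsAdmissibleMono E.conflation g) (w : i ≫ J.map g = 0) :
    E.kernels J M := by
  obtain ⟨B, j, _⟩ := IsInjectivelyCogenerating.exists_mono (J := J) (cokernel i)
  obtain ⟨b, hb⟩ := J.map_surjective (cokernel.π i ≫ j)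
  have hJ : J.map (biprod.lift b g) = J.map b ≫ J.map biprod.inl + J.map g ≫ J.map biprod.inr := by
    rw [biprod.lift_eq, J.map_add, J.map_comp, J.map_comp]
  have w' : i ≫ J.map (biprod.lift b g) = 0 := by
    rw [hJ, Preadditive.comp_add, reassoc_of% w, hb, Category.assoc, cokernel.condition_assoc]
    simp
  have h0 {T : K} (t : T ⟶ J.obj X) (ht : t ≫ J.map (biprod.lift b g) = 0) :
      t ≫ cokernel.π i = 0 := by
    rw [← cancel_mono j, Category.assoc, ← hb, zero_comp]
    have : b = biprod.lift b g ≫ biprod.fst := by simp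
    rw [this, J.map_comp, reassoc_of% ht, zero_comp]
  have hl : IsLimit (KernelFork.ofι i w') := KernelFork.IsLimit.ofι _ _
    (fun {T} t ht ↦ Abelian.monoLift i t (h0 t ht))
    (fun {T} t ht ↦ Abelian.monoLift_comp i t (h0 t ht))
    (fun {T} t ht m hm ↦ by rw [← cancel_mono i, hm, Abelian.monoLift_comp])
  exact ⟨_, _, _, E.isAdmissibleMono_biprod_lift hg b,
    ⟨IsLimit.conePointUniqueUpToIso hl (limit.isLimit _)⟩⟩

/-- This test mentions only morphisms from `M` to injectives, which makes the closure properties of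
a Serre class accessible. -/
lemma kernels_iff [IsInjectivelyCogenerating J] [HasBinaryBiproducts C] (M : K) : E.kernels J M ↔
    ∀ (X : C) (a : M ⟶ J.obj X), ∃ (Y : C) (g : X ⟶ Y), IsAdmissibleMono E.conflation g ∧
      a ≫ J.map g = 0 := by
  refine ⟨fun h X a ↦ E.exists_of_kernels J h a, fun h ↦ ?_⟩
  obtain ⟨X, i, _⟩ := IsInjectivelyCogenerating.exists_mono (J := J) M
  obtain ⟨Y, g, hg, w⟩ := h X i
  exact E.kernels_of_mono J i g hg w

/-- Subobjects are handled by injectivity of the values of `J`, quotients by precomposition, and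
extensions by composing two admissible monomorphisms. -/
instance [IsInjectivelyCogenerating J] [HasBinaryBiproducts C] : (E.kernels J).IsSerreClass where
  exists_zero := ⟨0, isZero_zero K, by
    rw [kernels_iff]
    exact fun X a ↦ ⟨X, 𝟙 X, E.mono_id X, (isZero_zero K).eq_of_src _ _⟩⟩
  prop_of_mono {N M} i _ hM := by
    rw [kernels_iff] at hM ⊢
    intro X a
    obtain ⟨Y, g, hg, w⟩ := hM X (Injective.factorThru a i)
    refine ⟨Y, g, hg, ?_⟩
    rw [← Injective.comp_factorThru a i, Category.assoc, w, comp_zero]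
  prop_of_epi {M Q} p _ hM := by
    rw [kernels_iff] at hM ⊢
    intro X a
    obtain ⟨Y, g, hg, w⟩ := hM X (p ≫ a)
    refine ⟨Y, g, hg, ?_⟩
    rw [← cancel_epi p, ← Category.assoc, w, comp_zero]
  prop_X₂_of_shortExact {S} hS h₁ h₃ := by
    rw [kernels_iff] at h₁ h₃ ⊢
    intro X a
    have := hS.epi_g
    obtain ⟨Y, g, hg, w⟩ := h₁ X (S.f ≫ a)
    obtain ⟨Z, g', hg', w'⟩ := h₃ Y (hS.exact.desc (a ≫ J.map g) (by simpa using w))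
    refine ⟨Z, g ≫ g', E.mono_comp _ _ hg hg', ?_⟩
    rw [J.map_comp, ← Category.assoc, ← hS.exact.g_desc (a ≫ J.map g) (by simpa using w),
      Category.assoc, w', comp_zero]

/-- Composed with the inclusion of `M` as the kernel of `J.map f`, the morphism `t` comes from some
x with x ≫ f = 0, and `f` is monic in `C`. -/
lemma eq_zero_of_kernels [J.Faithful] {M : K} (hM : E.kernels J M) {X : C}
    (t : J.obj X ⟶ M) : t = 0 := by
  obtain ⟨A, B, f, ⟨W, g, h, hS⟩, ⟨e⟩⟩ := hM
  obtain ⟨⟨hk⟩, _⟩ := E.isKernelCokernelPair _ hS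
  obtain ⟨x, hx⟩ := J.map_surjective (t ≫ e.hom ≫ kernel.ι (J.map f))
  have : x = 0 := by
    refine Fork.IsLimit.hom_ext hk (J.map_injective ?_)
    simp [hx]
  rw [← cancel_mono (e.hom ≫ kernel.ι (J.map f)), ← hx, this, J.map_zero, zero_comp]

/-- Morphisms from `J X` lift along epimorphisms with kernel in `E.kernels J`. -/
lemma exists_lift_of_epi [IsInjectivelyCogenerating J] [J.Faithful] {M N : K} (e : M ⟶ N) [Epi e]
    (he : E.kernels J (kernel e))
    {X : C} (t : J.obj X ⟶ N) : ∃ t' : J.obj X ⟶ M, t' ≫ e = t := by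
  obtain ⟨V, Y, f, ⟨W, g, h, hS⟩, ⟨α⟩⟩ := he
  obtain ⟨⟨hk⟩, _⟩ := E.isKernelCokernelPair _ hS
  let ι := α.hom ≫ kernel.ι (J.map f)
  have hι : ι ≫ J.map f = 0 := by simp [ι]
  let u : M ⟶ J.obj V := Injective.factorThru ι (kernel.ι e)
  have hu : kernel.ι e ≫ u = ι := Injective.comp_factorThru _ _
  let n : N ⟶ J.obj Y := (Abelian.epiDesc e (u ≫ J.map f) (by rw [reassoc_of% hu, hι]))
  have hn : e ≫ n = u ≫ J.map f := Abelian.comp_epiDesc _ _ _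
  have hng : n ≫ J.map g = 0 := by
    rw [← cancel_epi e, reassoc_of% hn, ← J.map_comp, h, J.map_zero, comp_zero, comp_zero]
  -- Here `y` is killed by `g`, and `f` is a kernel of `g`, so y = x ≫ f. The morphism `J.map x` is
  -- what the desired lift should become after `u`.
  obtain ⟨y, hy⟩ := J.map_surjective (t ≫ n)
  obtain ⟨x, hx⟩ := KernelFork.IsLimit.lift' hk y (J.map_injective (by
    dsimp
    rw [J.map_comp, hy, Category.assoc, hng, comp_zero, J.map_zero]))
  dsimp at x hx
  let a := pullback.fst e t
  let b := pullback.snd e t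
  have hab : a ≫ e = b ≫ t := pullback.condition
  -- The defect between `a ≫ u` and `b ≫ J.map x` is killed by `J.map f`, so it lies in `kernel e`.
  -- Subtracting it from `a` gives `a'`, which vanishes on the kernel of `b` and descends to the
  -- lift.
  let r : pullback e t ⟶ kernel e := kernel.lift (J.map f) (a ≫ u - b ≫ J.map x) (by
    rw [Preadditive.sub_comp, Category.assoc, Category.assoc, ← hn, reassoc_of% hab, ← J.map_comp,
      hx, hy, sub_self]) ≫ α.inv
  have hr : r ≫ ι = a ≫ u - b ≫ J.map x := by simp [r, ι]
  let a' := a - r ≫ kernel.ι e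
  have ha₁ : a' ≫ e = b ≫ t := by simp [a', hab]
  have ha₂ : a' ≫ u = b ≫ J.map x := by simp [a', hu, hr]
  have hb : kernel.ι b ≫ a' = 0 := by
    obtain ⟨z, hz⟩ : ∃ z, z ≫ kernel.ι e = kernel.ι b ≫ a' :=
      ⟨kernel.lift _ (kernel.ι b ≫ a') (by rw [Category.assoc, ha₁, kernel.condition_assoc,
        zero_comp]), kernel.lift_ι _ _ _⟩
    have : z ≫ ι = 0 := by
      rw [← hu, reassoc_of% hz, ha₂, kernel.condition_assoc, zero_comp]
    have hz0 : z = 0 := by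
      rw [← cancel_mono ι, this, zero_comp]
    rw [← hz, hz0, zero_comp]
  refine ⟨Abelian.epiDesc b a' hb, ?_⟩
  rw [← cancel_epi b, ← Category.assoc, Abelian.comp_epiDesc, ha₁]

variable [IsInjectivelyCogenerating J] [HasBinaryBiproducts C] [J.Faithful]

/-- The composite of `t` with the projection to `cokernel s` vanishes, so `t` lands in the image of
`s`; then it lifts along the epimorphism onto that image, whose kernel is in the class. -/
lemma exists_lift_of_isoModSerre {M N : K} (s : M ⟶ N) (hs : (E.kernels J).isoModSerre s) {X : C}
    (t : J.obj X ⟶ N) : ∃ t' : J.obj X ⟶ M, t' ≫ s = t := by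
  obtain ⟨h₁, h₂⟩ := hs
  have h₀ : t ≫ cokernel.π s = 0 := E.eq_zero_of_kernels J h₂ _
  obtain ⟨t', ht'⟩ := E.exists_lift_of_epi J (Abelian.factorThruImage s)
    h₁.isoModSerre_factorThruImage.1 (kernel.lift (cokernel.π s) t h₀)
  refine ⟨t', ?_⟩
  rw [← Abelian.image.fac s, reassoc_of% ht']
  exact kernel.lift_ι _ _ _

section Localization

variable {K' : Type u₃} [Category.{v₃} K'] [Abelian K'] (L : K ⥤ K')

omit [Abelian K'] in
-- The numerator of a left fraction lifts along its denominator, so fractions out of J X are honest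
-- morphisms.
lemma exists_map_eq [L.IsLocalization (E.kernels J).isoModSerre]
    {X : C} {M : K} (f : L.obj (J.obj X) ⟶ L.obj M) :
    ∃ g : J.obj X ⟶ M, L.map g = f := by
  obtain ⟨φ, rfl⟩ := Localization.exists_leftFraction L (E.kernels J).isoModSerre f
  obtain ⟨g, hg⟩ := E.exists_lift_of_isoModSerre J φ.s φ.hs φ.f
  refine ⟨g, ?_⟩
  have := Localization.inverts L _ _ φ.hs
  rw [← cancel_mono (L.map φ.s), ← L.map_comp, hg, φ.map_comp_map_s]

lemma eq_zero_of_map_eq_zero [L.Additive] [L.IsLocalization (E.kernels J).isoModSerre]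
    {X : C} {M : K} (f : J.obj X ⟶ M) (hf : L.map f = 0) : f = 0 := by
  rw [ObjectProperty.SerreClassLocalization.map_eq_zero_iff L (E.kernels J)] at hf
  rw [← Abelian.image.fac f, E.eq_zero_of_kernels J hf (Abelian.factorThruImage f), zero_comp]

omit [Abelian K'] in
lemma full_comp_localization [L.IsLocalization (E.kernels J).isoModSerre] :
    (J ⋙ L).Full where
  map_surjective f := by
    obtain ⟨g, rfl⟩ := E.exists_map_eq J L f
    obtain ⟨x, rfl⟩ := J.map_surjective g
    exact ⟨x, rfl⟩

lemma faithful_comp_localization [L.Additive] [L.IsLocalization (E.kernels J).isoModSerre] :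
    (J ⋙ L).Faithful where
  map_injective {X Y} f g h := by
    apply J.map_injective
    rw [← sub_eq_zero]
    apply E.eq_zero_of_map_eq_zero J L
    rw [L.map_sub, sub_eq_zero]
    exact h

omit [J.Faithful] in
lemma mono_map_of_isAdmissibleMono [L.Additive] [L.IsLocalization (E.kernels J).isoModSerre]
    {X Y : C} {f : X ⟶ Y} (hf : IsAdmissibleMono E.conflation f) :
    Mono (L.map (J.map f)) := by
  rw [ObjectProperty.SerreClassLocalization.mono_map_iff L (E.kernels J)]
  exact ⟨X, Y, f, hf, ⟨Iso.refl _⟩⟩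

/-- A monomorphism out of the image of `X` extends an admissible monomorphism. -/
lemma exists_comp_eq_map [L.Additive] [L.IsLocalization (E.kernels J).isoModSerre]
    {X : C} {G : K'} (m : L.obj (J.obj X) ⟶ G) [Mono m] :
    ∃ (Y : C) (j : X ⟶ Y) (h : G ⟶ L.obj (J.obj Y)), IsAdmissibleMono E.conflation j ∧
      m ≫ h = L.map (J.map j) := by
  have := Localization.essSurj L (E.kernels J).isoModSerre
  let e := L.objObjPreimageIso G
  obtain ⟨m', hm'⟩ := E.exists_map_eq J L (m ≫ e.inv)
  have : Mono (L.map m') := by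
    rw [hm']
    infer_instance
  rw [ObjectProperty.SerreClassLocalization.mono_map_iff L (E.kernels J)] at this
  -- The kernel of `m'` is in the Serre class, so some admissible `j` kills it. Then `J.map j`
  -- factors through the coimage of `m'` and extends along its embedding by injectivity.
  obtain ⟨Y, j, hj, w⟩ := E.exists_of_kernels J this (kernel.ι m')
  let d : Abelian.coimage m' ⟶ J.obj Y := cokernel.desc _ (J.map j) w
  let n := Injective.factorThru d (Abelian.factorThruCoimage m')
  have hn : m' ≫ n = J.map j := by
    rw [← Abelian.coimage.fac m', Category.assoc, Injective.comp_factorThru]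
    exact cokernel.π_desc _ _ _
  refine ⟨Y, j, e.inv ≫ L.map n, hj, ?_⟩
  rw [← Category.assoc, ← hm', ← L.map_comp, hn]

end Localization

end ExactStructure

end

/-! ### Extensions in the quotient category. -/

section

/-- The sequence `S` is compared by the five lemma with the pullback of `T` along `φ.τ₃`. -/
lemma isPullback_of_shortExact {B : Type u} [Category.{v} B] [Abelian B] {S T : ShortComplex B}
    (hS : S.ShortExact) (hT : T.ShortExact) (φ : S ⟶ T) [IsIso φ.τ₁] :
    IsPullback φ.τ₂ S.g T.g φ.τ₃ := by
  have sq := IsPullback.of_hasPullback T.g φ.τ₃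
  let i : T.X₁ ⟶ pullback T.g φ.τ₃ := pullback.lift T.f 0 (by simp)
  have hi : i ≫ pullback.snd T.g φ.τ₃ = 0 := pullback.lift_snd _ _ _
  have hP := shortExact_of_isPullback sq T.zero hT hi (pullback.lift_fst _ _ _)
  let ψ : S ⟶ ShortComplex.mk i (pullback.snd T.g φ.τ₃) hi :=
    { τ₁ := φ.τ₁
      τ₂ := pullback.lift φ.τ₂ S.g φ.comm₂₃
      τ₃ := 𝟙 _
      comm₁₂ := by
        apply sq.hom_ext
        · refine (Category.assoc _ _ _).trans (Eq.trans ?_ (Category.assoc _ _ _).symm)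
          exact (congrArg (φ.τ₁ ≫ ·) (pullback.lift_fst _ _ _)).trans
            (φ.comm₁₂.trans (congrArg (S.f ≫ ·) (pullback.lift_fst _ _ _)).symm)
        · refine (Category.assoc _ _ _).trans (Eq.trans ?_ (Category.assoc _ _ _).symm)
          exact ((congrArg (φ.τ₁ ≫ ·) hi).trans comp_zero).trans
            ((congrArg (S.f ≫ ·) (pullback.lift_snd _ _ _)).trans S.zero).symm
      comm₂₃ := (pullback.lift_snd _ _ _).trans (Category.comp_id _).symm }
  have : IsIso ψ.τ₁ := ‹IsIso φ.τ₁›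
  have : IsIso ψ.τ₃ := inferInstanceAs (IsIso (𝟙 _))
  have : IsIso ψ.τ₂ := ShortComplex.isIso₂_of_shortExact_of_isIso₁₃ ψ hS hP
  exact IsPullback.of_iso_pullback ⟨φ.comm₂₃⟩ (asIso ψ.τ₂) (pullback.lift_fst _ _ _)
    (pullback.lift_snd _ _ _)

lemma isPullback_of_shortExact' {B : Type u} [Category.{v} B] [Abelian B] {X Y Z Y' Z' : B}
    {f : X ⟶ Y} {g : Y ⟶ Z} {w : f ≫ g = 0} (h : (ShortComplex.mk f g w).ShortExact)
    {f' : X ⟶ Y'} {g' : Y' ⟶ Z'} {w' : f' ≫ g' = 0} (h' : (ShortComplex.mk f' g' w').ShortExact)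
    {b : Y ⟶ Y'} {c : Z ⟶ Z'} (hb : f ≫ b = f') (hc : g ≫ c = b ≫ g') : IsPullback b g g' c := by
  let φ : ShortComplex.mk f g w ⟶ ShortComplex.mk f' g' w' :=
    { τ₁ := 𝟙 X, τ₂ := b, τ₃ := c, comm₁₂ := by simp [hb], comm₂₃ := by simp [hc] }
  have : IsIso φ.τ₁ := inferInstanceAs (IsIso (𝟙 X))
  exact isPullback_of_shortExact h h' φ

namespace ExactStructure

variable {C : Type u₁} [Category.{w} C] [Preadditive C] (E : ExactStructure C)
  {K : Type u₂} [Category.{w} K] [Abelian K] (J : C ⥤ K)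
  [J.Full] [J.Faithful] [J.Additive] [IsInjectivelyCogenerating J] [HasBinaryBiproducts C]
  {K' : Type u₃} [Category.{v₃} K'] [Abelian K'] (L : K ⥤ K') [L.Additive]

/-- `J` preserves cokernels because its values cogenerate, and `L` is right exact. The kernel of
`J.map f` lies in the Serre class and so is killed by `L`. -/
lemma shortExact_map_of_conflation [PreservesFiniteColimits L]
    [L.IsLocalization (E.kernels J).isoModSerre]
    {X Y Z : C} {f : X ⟶ Y} {g : Y ⟶ Z} {h : f ≫ g = 0}
    (hS : E.conflation (ShortComplex.mk f g h)) :
    ((ShortComplex.mk f g h).map (J ⋙ L)).ShortExact := by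
  obtain ⟨_, ⟨hc⟩⟩ := E.isKernelCokernelPair _ hS
  have := preservesColimit_of_mono_to_image J
    (IsInjectivelyCogenerating.exists_mono (J := J)) (parallelPair f 0)
  have hc' := CokernelCofork.mapIsColimit _ hc (J ⋙ L)
  refine ShortComplex.ShortExact.mk' (ShortComplex.exact_of_g_is_cokernel _ hc')
    (E.mono_map_of_isAdmissibleMono J L ⟨_, _, _, hS⟩) ?_
  exact Cofork.IsColimit.epi hc'

/-- The morphism `f` extends to the image of an admissible monomorphism X ⟶ Y with cokernel W, and
the induced morphism on cokernels comes from some V ⟶ W. Both `G` and the image of the pullback in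
`C` are pullbacks of the same cospan, because the sequences share their kernel. -/
lemma exists_iso_of_shortExact [PreservesFiniteColimits L]
    [L.IsLocalization (E.kernels J).isoModSerre]
    {X V : C} {G : K'} {f : L.obj (J.obj X) ⟶ G}
    {g : G ⟶ L.obj (J.obj V)} {w : f ≫ g = 0} (hS : (ShortComplex.mk f g w).ShortExact) :
    ∃ Z : C, Nonempty (G ≅ L.obj (J.obj Z)) := by
  have := hS.mono_f
  dsimp at this
  obtain ⟨Y, j, h, ⟨W, q, z, hj⟩, hh⟩ := E.exists_comp_eq_map J L f
  have hjW := E.shortExact_map_of_conflation J L hj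
  have hf : f ≫ h ≫ L.map (J.map q) = 0 := by
    rw [reassoc_of% hh, ← L.map_comp, ← J.map_comp, z, J.map_zero, L.map_zero]
  have := hS.epi_g
  obtain ⟨v', hv'⟩ : ∃ v' : L.obj (J.obj V) ⟶ L.obj (J.obj W), g ≫ v' = h ≫ L.map (J.map q) :=
    ⟨hS.exact.desc (h ≫ L.map (J.map q)) hf, hS.exact.g_desc _ _⟩
  have := E.full_comp_localization J L
  obtain ⟨v, hv⟩ := (J ⋙ L).map_surjective v'
  obtain ⟨Z, p, q', sq, hq'⟩ := E.pullback_epi q v ⟨_, _, _, hj⟩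
  obtain ⟨x, hx, hxp, hZ⟩ := E.conflation_of_isPullback hj sq hq'
  have hZ' := E.shortExact_map_of_conflation J L hZ
  have sq₁ : IsPullback h g (L.map (J.map q)) v' := isPullback_of_shortExact' hS hjW hh hv'
  have sq₂ : IsPullback (L.map (J.map p)) (L.map (J.map q')) (L.map (J.map q)) v' :=
    isPullback_of_shortExact' hZ' hjW
      (by simp [← hxp]) (by simpa [← hv] using congr((J ⋙ L).map $(sq.w.symm)))
  exact ⟨Z, ⟨sq₁.isoIsPullback _ _ sq₂⟩⟩

omit [J.Faithful] in
lemma exists_mono_to_localization [L.IsLocalization (E.kernels J).isoModSerre]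
    (G : K') : ∃ (X : C) (i : G ⟶ L.obj (J.obj X)), Mono i := by
  have := Localization.essSurj L (E.kernels J).isoModSerre
  obtain ⟨X, i, _⟩ := IsInjectivelyCogenerating.exists_mono (J := J) (L.objPreimage G)
  have : Mono (L.map i) := by
    rw [ObjectProperty.SerreClassLocalization.mono_map_iff L (E.kernels J)]
    exact ObjectProperty.monoModSerre_of_mono _ i
  exact ⟨X, (L.objObjPreimageIso G).inv ≫ L.map i, CategoryTheory.mono_comp _ _⟩

end ExactStructure

end

/-! ### Passage from the quotient of the small category to its ind-objects. -/

section

attribute [local instance] Cardinal.fact_isRegular_aleph0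

lemma isSeparating_indYoneda (K : Type w) [SmallCategory K] :
    ObjectProperty.IsSeparating (.ofObj (Ind.yoneda (C := K)).obj) := by
  intro M N f g h
  obtain ⟨J, _, _, F, c, hc, rfl⟩ := exists_presentation_indYoneda M
  exact hc.hom_ext fun j ↦ h _ ⟨F.obj j⟩ (c.ι.app j)

instance isGrothendieckAbelian_ind (K : Type w) [SmallCategory K] [Abelian K] :
    IsGrothendieckAbelian.{w} (Ind K) where
  hasFilteredColimitsOfSize := ⟨fun _ _ _ ↦ inferInstance⟩
  ab5OfSize := ⟨fun J _ _ ↦ by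
    have : HasExactColimitsOfShape J (Kᵒᵖ ⥤ Type w) := inferInstance
    exact HasExactColimitsOfShape.domain_of_functor J (Ind.inclusion K)⟩
  hasSeparator := ⟨_, (isSeparator_sigma _).2 (isSeparating_indYoneda K)⟩

section

variable {A : Type u₁} [Category.{w} A] {K : Type w} [SmallCategory K] [Abelian K]

/-- An injective object containing `N` lies in the essential image: a morphism to it from a
representable G factors, by injectivity, through an embedding of G into a finitely presented object
of the image. -/
lemma exists_mono_to_image [IsFinitelyAccessibleCategory.{w} A] (Φ : A ⥤ Ind K)
    [PreservesFilteredColimitsOfSize.{w, w} Φ] [Φ.Full] [Φ.Faithful]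
    (h : ∀ G : K, ∃ (X : A) (G' : K) (i : G ⟶ G'), Mono i ∧ IsFinitelyPresentable.{w} X ∧
      Nonempty (Φ.obj X ≅ Ind.yoneda.obj G'))
    (hfp : ∀ X : A, IsFinitelyPresentable.{w} X → IsFinitelyPresentable.{w} (Φ.obj X))
    (N : Ind K) : ∃ (X : A) (i : N ⟶ Φ.obj X), Mono i := by
  have hle : fpImage.{w} Φ ≤ ObjectProperty.isFinitelyPresentable.{w} (Ind K) := by
    rintro Y ⟨X, hX, ⟨e⟩⟩
    have := hfp X hX
    exact isCardinalPresentable_of_iso e _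
  have hI : Φ.essImage (Injective.under N) := by
    rw [essImage_eq_ind_fpImage, ObjectProperty.ind_iff_exists hle]
    intro Z g _
    obtain ⟨G, ⟨e⟩⟩ := exists_iso_indYoneda_of_isFinitelyPresentable Z
    obtain ⟨X, G', i, _, hX, ⟨e'⟩⟩ := h G
    refine ⟨_, e.inv ≫ Ind.yoneda.map i, Injective.factorThru (e.hom ≫ g) (Ind.yoneda.map i), ?_,
      X, hX, ⟨e'⟩⟩
    rw [Category.assoc, Injective.comp_factorThru, Iso.inv_hom_id_assoc]
  obtain ⟨X, ⟨e⟩⟩ := hI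
  exact ⟨X, Injective.ι N ≫ e.inv, inferInstance⟩

end

section

variable {A : Type u₁} [Category.{w} A] [Preadditive A] [HasFiniteBiproducts A]
  [IsFinitelyAccessibleCategory.{w} A] [HasBinaryBiproducts (Fp A)] (E : ExactStructure (Fp A))
  {K K' : Type w} [SmallCategory K] [Abelian K] (J : Fp A ⥤ K)
  [J.Full] [J.Faithful] [J.Additive] [IsInjectivelyCogenerating J]
  [SmallCategory K'] [Abelian K'] (L : K ⥤ K') [L.Additive]

/-- The properties of a functor to ind-objects extending `J ⋙ L`, where `L` is the localization
at the kernels of the images of admissible monomorphisms. -/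
theorem properties_of_restriction_iso
    [PreservesFiniteColimits L] [L.IsLocalization (E.kernels J).isoModSerre]
    (Φ : A ⥤ Ind K') [PreservesFilteredColimitsOfSize.{w, w} Φ]
    (e : (ObjectProperty.isFinitelyPresentable.{w} A).ι ⋙ Φ ≅ J ⋙ L ⋙ Ind.yoneda) :
    Φ.Full ∧ Φ.Faithful ∧ Φ.Additive ∧
      (∀ {X Y : A} (f : X ⟶ Y), PreservesColimit (parallelPair f 0) Φ) ∧
      (∀ S : ShortComplex (Ind K'), S.ShortExact → Φ.essImage S.X₁ → Φ.essImage S.X₃ →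
        Φ.essImage S.X₂) := by
  have hfp (X : A) (hX : IsFinitelyPresentable.{w} X) : IsFinitelyPresentable.{w} (Φ.obj X) :=
    have : IsFinitelyPresentable.{w} ((J ⋙ L ⋙ Ind.yoneda).obj ⟨X, hX⟩) :=
      isFinitelyPresentable_indYoneda _
    isCardinalPresentable_of_iso (e.app ⟨X, hX⟩).symm _
  have := E.full_comp_localization J L
  have := E.faithful_comp_localization J L
  have : (J ⋙ L ⋙ Ind.yoneda).Full := inferInstanceAs ((J ⋙ L) ⋙ Ind.yoneda).Full
  have : (J ⋙ L ⋙ Ind.yoneda).Faithful := inferInstanceAs ((J ⋙ L) ⋙ Ind.yoneda).Faithful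
  have : ((ObjectProperty.isFinitelyPresentable.{w} A).ι ⋙ Φ).Full := Functor.Full.of_iso e.symm
  have : ((ObjectProperty.isFinitelyPresentable.{w} A).ι ⋙ Φ).Faithful :=
    Functor.Faithful.of_iso e.symm
  have hff (X Y : A) (hX : IsFinitelyPresentable.{w} X) (hY : IsFinitelyPresentable.{w} Y) :
      Function.Bijective (Φ.map : (X ⟶ Y) → _) := by
    have h₁ := (Functor.FullyFaithful.ofFullyFaithful
      ((ObjectProperty.isFinitelyPresentable.{w} A).ι ⋙ Φ)).map_bijective ⟨X, hX⟩ ⟨Y, hY⟩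
    have h₂ := (ObjectProperty.isFinitelyPresentable.{w} A).fullyFaithfulι.map_bijective
      ⟨X, hX⟩ ⟨Y, hY⟩
    exact (Function.Bijective.of_comp_iff _ h₂).1 h₁
  have hFull := full_of_isFinitelyPresentable Φ hfp hff
  have hFaithful := faithful_of_isFinitelyPresentable Φ hfp hff
  have hmono := exists_mono_to_image Φ (fun G ↦ by
    obtain ⟨X, i, hi⟩ := E.exists_mono_to_localization J L G
    exact ⟨X.obj, _, i, hi, X.property, ⟨e.app X⟩⟩) hfp
  have : HasBinaryBiproducts A := hasBinaryBiproducts_of_finite_biproducts A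
  refine ⟨hFull, hFaithful, additive_of_mono_to_image Φ hmono,
    fun f ↦ preservesColimit_of_mono_to_image Φ hmono _, ?_⟩
  refine essImage_of_shortExact Φ hfp (fun p _ ↦ isFinitelyPresentable_kernel p) ?_
  rintro S hS hS₂ ⟨X, hX, ⟨a⟩⟩ ⟨V, hV, ⟨b⟩⟩
  -- All three terms are representable, and `Ind.yoneda` reflects short exactness, so the extension
  -- already lives in `K'`.
  obtain ⟨G, ⟨c⟩⟩ := exists_iso_indYoneda_of_isFinitelyPresentable S.X₂
  let a' : Ind.yoneda.obj (L.obj (J.obj ⟨X, hX⟩)) ≅ S.X₁ := (e.app ⟨X, hX⟩).symm ≪≫ a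
  let b' : Ind.yoneda.obj (L.obj (J.obj ⟨V, hV⟩)) ≅ S.X₃ := (e.app ⟨V, hV⟩).symm ≪≫ b
  obtain ⟨f, hf⟩ := (Ind.yoneda (C := K')).map_surjective (a'.hom ≫ S.f ≫ c.inv)
  obtain ⟨g, hg⟩ := (Ind.yoneda (C := K')).map_surjective (c.hom ≫ S.g ≫ b'.inv)
  have w : f ≫ g = 0 := (Ind.yoneda (C := K')).map_injective (by
    rw [Functor.map_comp, hf, hg]
    simp)
  let T := ShortComplex.mk f g w
  have hT : T.ShortExact := by
    have : (T.map (Ind.yoneda (C := K'))).ShortExact :=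
      ShortComplex.shortExact_of_iso
        (ShortComplex.isoMk a'.symm c.symm b'.symm
          ((congrArg (a'.inv ≫ ·) hf).trans (a'.inv_hom_id_assoc _))
          ((congrArg (c.inv ≫ ·) hg).trans (c.inv_hom_id_assoc _))) hS
    exact ShortComplex.ShortExact.mk' ((T.exact_map_iff_of_faithful (Ind.yoneda (C := K'))).1
      this.exact) (Functor.mono_of_mono_map Ind.yoneda this.mono_f)
      (Functor.epi_of_epi_map Ind.yoneda this.epi_g)
  obtain ⟨Z, ⟨d⟩⟩ := E.exists_iso_of_shortExact J L hT
  exact ⟨Z.obj, Z.property, ⟨e.app Z ≪≫ (Ind.yoneda.mapIso d.symm) ≪≫ c⟩⟩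

end

end

/-! ### Finitely presented functors in terms of generators and relations. -/

section

section

variable {C : Type u} [Category.{w} C]

lemma exact_of_evaluation {S : ShortComplex (C ⥤ AddCommGrpCat.{w})}
    (h : ∀ Z, (S.map ((evaluation C AddCommGrpCat.{w}).obj Z)).Exact) : S.Exact := by
  rw [ShortComplex.exact_iff_isZero_homology, Functor.isZero_iff]
  intro Z
  exact ((ShortComplex.exact_iff_isZero_homology _).1 (h Z)).of_iso
    (S.mapHomologyIso ((evaluation C AddCommGrpCat.{w}).obj Z)).symm

lemma exists_of_exact {S : ShortComplex (C ⥤ AddCommGrpCat.{w})} (h : S.Exact) {Z : C}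
    (y : S.X₂.obj Z) (hy : S.g.app Z y = 0) : ∃ x, S.f.app Z x = y := by
  have := h.map ((evaluation C AddCommGrpCat.{w}).obj Z)
  rw [ShortComplex.ab_exact_iff] at this
  exact this y hy

lemma surjective_app_of_epi {F G : C ⥤ AddCommGrpCat.{w}} (p : F ⟶ G) [Epi p] (Z : C) :
    Function.Surjective (p.app Z) :=
  (AddCommGrpCat.epi_iff_surjective _).1 inferInstance

lemma injective_app_of_mono {F G : C ⥤ AddCommGrpCat.{w}} (i : F ⟶ G) [Mono i] (Z : C) :
    Function.Injective (i.app Z) :=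
  (AddCommGrpCat.mono_iff_injective _).1 inferInstance

lemma comp_app_eq_zero {F G H : C ⥤ AddCommGrpCat.{w}} {f : F ⟶ G} {g : G ⟶ H} (w : f ≫ g = 0)
    {Z : C} (x : F.obj Z) : g.app Z (f.app Z x) = 0 :=
  congr(($w).app Z x)

lemma map_comp_apply (F : C ⥤ AddCommGrpCat.{w}) {X Y Z : C} (f : X ⟶ Y) (g : Y ⟶ Z)
    (x : F.obj X) : F.map (f ≫ g) x = F.map g (F.map f x) :=
  congr($(F.map_comp f g) x)

/-- `x` generates `F`, and its annihilator is generated by `r`. -/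
structure IsPresentedBy (F : C ⥤ AddCommGrpCat.{w}) {X Y : C} (r : X ⟶ Y) (x : F.obj X) :
    Prop where
  exists_map_eq {Z : C} (z : F.obj Z) : ∃ t : X ⟶ Z, F.map t x = z
  map_eq_zero_iff {Z : C} (t : X ⟶ Z) : F.map t x = 0 ↔ ∃ s, r ≫ s = t

lemma IsPresentedBy.hom_ext {F G : C ⥤ AddCommGrpCat.{w}} {X Y : C} {r : X ⟶ Y} {x : F.obj X}
    (h : IsPresentedBy F r x) {f g : F ⟶ G} (hfg : f.app X x = g.app X x) : f = g := by
  ext Z z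
  obtain ⟨t, rfl⟩ := h.exists_map_eq z
  rw [NatTrans.naturality_apply, NatTrans.naturality_apply, hfg]

end

variable {C : Type u} [Category.{w} C] [Preadditive C]

/-- The Yoneda lemma for additive functors. -/
def yonedaHom (F : C ⥤ AddCommGrpCat.{w}) [F.Additive] {X : C} (x : F.obj X) :
    preadditiveCoyoneda.obj (op X) ⟶ F where
  app Y := AddCommGrpCat.ofHom
    { toFun := fun g ↦ F.map g x
      map_zero' := congr($(F.map_zero X Y) x)
      map_add' := fun g g' ↦ congr($(F.map_add (f := (g : X ⟶ Y)) (g := g')) x) }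
  naturality Y Z h := by
    ext g
    exact congr($(F.map_comp (g : X ⟶ Y) h) x)

lemma app_eq_map {F : C ⥤ AddCommGrpCat.{w}} {X : C} (p : preadditiveCoyoneda.obj (op X) ⟶ F)
    {Z : C} (t : X ⟶ Z) : p.app Z t = F.map t (p.app X (𝟙 X)) := by
  have h := congr($(p.naturality (t : X ⟶ Z)) (𝟙 X))
  exact (congr(p.app Z $(Category.id_comp (t : X ⟶ Z)))).symm.trans h

lemma map_add_apply (F : C ⥤ AddCommGrpCat.{w}) [F.Additive] {X Y : C} (f g : X ⟶ Y)
    (x : F.obj X) : F.map (f + g) x = F.map f x + F.map g x :=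
  congr($(F.map_add (f := f) (g := g)) x)

lemma map_sub_apply (F : C ⥤ AddCommGrpCat.{w}) [F.Additive] {X Y : C} (f g : X ⟶ Y)
    (x : F.obj X) : F.map (f - g) x = F.map f x - F.map g x :=
  congr($(F.map_sub (f := f) (g := g)) x)

lemma isPresentedBy_of_iso_cokernel {F : C ⥤ AddCommGrpCat.{w}} {X Y : C} (r : X ⟶ Y)
    (e : F ≅ cokernel (preadditiveCoyoneda.map r.op)) : ∃ x, IsPresentedBy F r x := by
  let p : preadditiveCoyoneda.obj (op X) ⟶ F := cokernel.π (preadditiveCoyoneda.map r.op) ≫ e.inv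
  have hp : Epi p := by
    dsimp only [p]
    infer_instance
  have hrp : preadditiveCoyoneda.map r.op ≫ p = 0 := by simp [p]
  have hS : (ShortComplex.mk _ p hrp).Exact := by
    refine ShortComplex.exact_of_g_is_cokernel _ (IsColimit.ofIsoColimit (cokernelIsCokernel _)
      (Cofork.ext e.symm ?_))
    rfl
  refine ⟨p.app X (𝟙 X), fun z ↦ ?_, fun {Z} t ↦ ?_⟩
  · obtain ⟨t, ht⟩ := surjective_app_of_epi p _ z
    exact ⟨t, (app_eq_map p _).symm.trans ht⟩
  · rw [← app_eq_map p t]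
    refine ⟨fun h ↦ exists_of_exact hS (Z := Z) t h, ?_⟩
    rintro ⟨s, rfl⟩
    exact comp_app_eq_zero hrp (Z := Z) s

lemma IsPresentedBy.nonempty_iso {F : C ⥤ AddCommGrpCat.{w}} [F.Additive] {X Y : C} {r : X ⟶ Y}
    {x : F.obj X} (h : IsPresentedBy F r x) :
    Nonempty (F ≅ cokernel (preadditiveCoyoneda.map r.op)) := by
  have hrp : preadditiveCoyoneda.map r.op ≫ yonedaHom F x = 0 := by
    ext Z s
    exact (h.map_eq_zero_iff (r ≫ s)).2 ⟨s, rfl⟩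
  have hS : (ShortComplex.mk _ (yonedaHom F x) hrp).Exact := by
    refine exact_of_evaluation fun Z ↦ ?_
    rw [ShortComplex.ab_exact_iff]
    exact fun t ht ↦ (h.map_eq_zero_iff t).1 ht
  have (Z : C) : Epi ((yonedaHom F x).app Z) := (AddCommGrpCat.epi_iff_surjective _).2
    fun z ↦ h.exists_map_eq z
  have : Epi (yonedaHom F x) := NatTrans.epi_of_epi_app _
  exact ⟨hS.gIsCokernel.coconePointUniqueUpToIso (colimit.isColimit _)⟩

/-- Closure properties can thus be checked on one generator and one relation, without diagrams of
functors. -/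
lemma isFpFunctor_iff (F : C ⥤ AddCommGrpCat.{w}) : isFpFunctor C F ↔
    F.Additive ∧ ∃ (X Y : C) (r : X ⟶ Y) (x : F.obj X), IsPresentedBy F r x := by
  refine ⟨fun h ↦ ⟨h.additive, ?_⟩, ?_⟩
  · obtain ⟨X, Y, r, ⟨e⟩⟩ := h
    exact ⟨X, Y, r, isPresentedBy_of_iso_cokernel r e⟩
  · rintro ⟨_, X, Y, r, x, h⟩
    exact ⟨X, Y, r, h.nonempty_iso⟩

lemma additive_of_mono {F G : C ⥤ AddCommGrpCat.{w}} [G.Additive] (i : F ⟶ G) [Mono i] :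
    F.Additive where
  map_add {X Y f g} := by
    have : Mono (i.app Y) := inferInstance
    rw [← cancel_mono (i.app Y)]
    simp only [i.naturality, Preadditive.add_comp, Functor.map_add, Preadditive.comp_add]

lemma additive_of_epi {F G : C ⥤ AddCommGrpCat.{w}} [F.Additive] (p : F ⟶ G) [Epi p] :
    G.Additive where
  map_add {X Y f g} := by
    have : Epi (p.app X) := inferInstance
    rw [← cancel_epi (p.app X)]
    simp only [← p.naturality, Preadditive.add_comp, Functor.map_add, Preadditive.comp_add]

variable (C) in
/-- Weak cokernels: every morphism annihilating `f` factors, not necessarily uniquely, through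
a fixed morphism annihilating `f`. -/
class HasWeakCokernels : Prop where
  exists_weakCokernel {X Y : C} (f : X ⟶ Y) : ∃ (Z : C) (g : Y ⟶ Z), f ≫ g = 0 ∧
    ∀ {W : C} (h : Y ⟶ W), f ≫ h = 0 → ∃ k, g ≫ k = h

section

variable [HasBinaryBiproducts C]

/-- With weak cokernels, annihilators of elements of finitely presented functors are generated
by one morphism. -/
lemma IsPresentedBy.exists_annihilator [HasWeakCokernels C] {F : C ⥤ AddCommGrpCat.{w}}
    [F.Additive] {X Y : C} {r : X ⟶ Y} {x : F.obj X} (h : IsPresentedBy F r x) {Z : C}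
    (z : F.obj Z) : ∃ (Z' : C) (u : Z ⟶ Z'), ∀ {W : C} (t : Z ⟶ W),
      F.map t z = 0 ↔ ∃ s, u ≫ s = t := by
  obtain ⟨a, rfl⟩ := h.exists_map_eq z
  -- The morphism `t` kills the element `F.map a x` iff a ≫ t = r ≫ s for some s. A weak cokernel of
  -- (a, -r), that is a weak pushout of `a` and `r`, is universal for such pairs.
  obtain ⟨V, g, hg, hg'⟩ := HasWeakCokernels.exists_weakCokernel (biprod.lift a (-r))
  have hV : a ≫ biprod.inl ≫ g = r ≫ biprod.inr ≫ g := by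
    have : a ≫ biprod.inl ≫ g - r ≫ biprod.inr ≫ g = biprod.lift a (-r) ≫ g := by
      rw [biprod.lift_eq, Preadditive.add_comp]
      simp [sub_eq_add_neg]
    rw [← sub_eq_zero, this, hg]
  refine ⟨V, biprod.inl ≫ g, fun {W} t ↦ ?_⟩
  rw [← map_comp_apply, h.map_eq_zero_iff]
  constructor
  · rintro ⟨s, hs⟩
    obtain ⟨k, hk⟩ := hg' (biprod.desc t s) (by simp [hs])
    exact ⟨k, by rw [Category.assoc, hk, biprod.inl_desc]⟩
  · rintro ⟨s, rfl⟩
    exact ⟨biprod.inr ≫ g ≫ s, by simpa using (congrArg (· ≫ s) hV).symm⟩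

/-- If `u` generates the annihilator of the image of the generator `x`, then `S.X₂.map u x`
generates the kernel; its own annihilator gives the relation. -/
lemma isFpFunctor_of_kernel [HasWeakCokernels C] {S : ShortComplex (C ⥤ AddCommGrpCat.{w})}
    (hS : S.Exact) [Mono S.f] (h₂ : isFpFunctor C S.X₂) (h₃ : isFpFunctor C S.X₃) :
    isFpFunctor C S.X₁ := by
  rw [isFpFunctor_iff] at h₂ h₃ ⊢
  obtain ⟨_, X, Y, r, x, hx⟩ := h₂
  obtain ⟨_, _, _, _, _, hz⟩ := h₃
  refine ⟨additive_of_mono S.f, ?_⟩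
  obtain ⟨Z, u, hu⟩ := hz.exists_annihilator (S.g.app X x)
  obtain ⟨y, hy⟩ := exists_of_exact hS (S.X₂.map u x) (by
    rw [NatTrans.naturality_apply, hu]
    exact ⟨𝟙 _, Category.comp_id _⟩)
  obtain ⟨Z', v, hv⟩ := hx.exists_annihilator (S.X₂.map u x)
  refine ⟨Z, Z', v, y, fun {W} z ↦ ?_, fun {W} t ↦ ?_⟩
  · obtain ⟨t, ht⟩ := hx.exists_map_eq (S.f.app W z)
    obtain ⟨k, rfl⟩ := (hu t).1 (by
      rw [← NatTrans.naturality_apply, ht]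
      exact comp_app_eq_zero S.zero z)
    refine ⟨k, injective_app_of_mono S.f W ?_⟩
    rw [NatTrans.naturality_apply, hy, ← ht, map_comp_apply]
  · rw [← hv, ← hy, ← NatTrans.naturality_apply]
    exact (map_eq_zero_iff _ (injective_app_of_mono S.f W)).symm

/-- The image of the generator of `S.X₂` generates; its relations are the old one `r` together with
`a`, which expresses the image of the generator of `S.X₁`. -/
lemma isFpFunctor_of_cokernel {S : ShortComplex (C ⥤ AddCommGrpCat.{w})}
    (hS : S.Exact) [Epi S.g] (h₁ : isFpFunctor C S.X₁) (h₂ : isFpFunctor C S.X₂) :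
    isFpFunctor C S.X₃ := by
  rw [isFpFunctor_iff] at h₁ h₂ ⊢
  obtain ⟨_, X, X', q, x, hx⟩ := h₁
  obtain ⟨_, Y, Y', r, y, hy⟩ := h₂
  refine ⟨additive_of_epi S.g, ?_⟩
  obtain ⟨a, ha⟩ := hy.exists_map_eq (S.f.app X x)
  refine ⟨Y, X ⊞ Y', biprod.lift a r, S.g.app Y y, fun {W} z ↦ ?_, fun {W} t ↦ ?_⟩
  · obtain ⟨z', rfl⟩ := surjective_app_of_epi S.g _ z
    obtain ⟨t, rfl⟩ := hy.exists_map_eq z'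
    exact ⟨t, (NatTrans.naturality_apply S.g t y).symm⟩
  · rw [← NatTrans.naturality_apply]
    constructor
    · intro ht
      obtain ⟨z, hz⟩ := exists_of_exact hS _ ht
      obtain ⟨b, rfl⟩ := hx.exists_map_eq z
      obtain ⟨s, hs⟩ := (hy.map_eq_zero_iff (t - a ≫ b)).1 (by
        rw [map_sub_apply, ← hz, NatTrans.naturality_apply, map_comp_apply, ha, sub_self])
      exact ⟨biprod.desc b s, by simp [hs]⟩
    · rintro ⟨s, rfl⟩
      have : biprod.lift a r ≫ s = a ≫ biprod.inl ≫ s + r ≫ biprod.inr ≫ s := by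
        rw [biprod.lift_eq, Preadditive.add_comp, Category.assoc, Category.assoc]
      have h0 : S.X₂.map (r ≫ biprod.inr ≫ s) y = 0 := (hy.map_eq_zero_iff _).2 ⟨_, rfl⟩
      rw [this, map_add_apply, h0, add_zero, map_comp_apply, ha, ← NatTrans.naturality_apply]
      exact comp_app_eq_zero S.zero _

lemma isFpFunctor_biprod {F G : C ⥤ AddCommGrpCat.{w}} (hF : isFpFunctor C F)
    (hG : isFpFunctor C G) : isFpFunctor C (F ⊞ G) := by
  rw [isFpFunctor_iff] at hF hG ⊢
  obtain ⟨_, X, X', q, x, hx⟩ := hF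
  obtain ⟨_, Y, Y', r, y, hy⟩ := hG
  have ext {Z : C} {a b : (F ⊞ G).obj Z} (h₁ : (biprod.fst : F ⊞ G ⟶ F).app Z a =
      (biprod.fst : F ⊞ G ⟶ F).app Z b) (h₂ : (biprod.snd : F ⊞ G ⟶ G).app Z a =
      (biprod.snd : F ⊞ G ⟶ G).app Z b) : a = b := by
    have h (c : (F ⊞ G).obj Z) : (biprod.inl : F ⟶ F ⊞ G).app Z ((biprod.fst : F ⊞ G ⟶ F).app Z c) +
      (biprod.inr : G ⟶ F ⊞ G).app Z ((biprod.snd : F ⊞ G ⟶ G).app Z c) = c :=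
        congr(($(biprod.total (X := F) (Y := G))).app Z c)
    rw [← h a, ← h b, h₁, h₂]
  have ex {Z : C} (a : F.obj Z) (b : G.obj Z) : ∃ c : (F ⊞ G).obj Z,
      (biprod.fst : F ⊞ G ⟶ F).app Z c = a ∧ (biprod.snd : F ⊞ G ⟶ G).app Z c = b := by
    refine ⟨(biprod.inl : F ⟶ F ⊞ G).app Z a + (biprod.inr : G ⟶ F ⊞ G).app Z b, ?_, ?_⟩
    · rw [map_add]
      exact (congr_arg₂ (· + ·) congr(($(biprod.inl_fst (X := F) (Y := G))).app Z a)
        congr(($(biprod.inr_fst (X := F) (Y := G))).app Z b)).trans (add_zero a)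
    · rw [map_add]
      exact (congr_arg₂ (· + ·) congr(($(biprod.inl_snd (X := F) (Y := G))).app Z a)
        congr(($(biprod.inr_snd (X := F) (Y := G))).app Z b)).trans (zero_add b)
  refine ⟨⟨fun {Z W f g} ↦ ?_⟩, X ⊞ Y, X' ⊞ Y', biprod.map q r, ?_⟩
  · ext a
    apply ext <;> simp only [NatTrans.naturality_apply, map_add_apply, AddCommGrpCat.hom_add,
      AddMonoidHom.add_apply, map_add]
  obtain ⟨c, hc₁, hc₂⟩ := ex (F.map biprod.inl x) (G.map biprod.inr y)
  refine ⟨c, fun {Z} z ↦ ?_, fun {Z} t ↦ ?_⟩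
  · obtain ⟨a, ha⟩ := hx.exists_map_eq ((biprod.fst : F ⊞ G ⟶ F).app Z z)
    obtain ⟨b, hb⟩ := hy.exists_map_eq ((biprod.snd : F ⊞ G ⟶ G).app Z z)
    refine ⟨biprod.desc a b, ext ?_ ?_⟩
    · rw [NatTrans.naturality_apply, hc₁, ← map_comp_apply, biprod.inl_desc, ha]
    · rw [NatTrans.naturality_apply, hc₂, ← map_comp_apply, biprod.inr_desc, hb]
  · have : (F ⊞ G).map t c = 0 ↔ F.map (biprod.inl ≫ t) x = 0 ∧ G.map (biprod.inr ≫ t) y = 0 := by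
      rw [map_comp_apply, map_comp_apply, ← hc₁, ← hc₂, ← NatTrans.naturality_apply,
        ← NatTrans.naturality_apply]
      refine ⟨fun h ↦ by simp [h], fun h ↦ ext ?_ ?_⟩
      · rw [h.1, map_zero]
      · rw [h.2, map_zero]
    rw [this, hx.map_eq_zero_iff, hy.map_eq_zero_iff]
    constructor
    · rintro ⟨⟨a, ha⟩, ⟨b, hb⟩⟩
      exact ⟨biprod.desc a b, by ext <;> simp [ha, hb]⟩
    · rintro ⟨s, rfl⟩
      exact ⟨⟨biprod.inl ≫ s, by simp⟩, ⟨biprod.inr ≫ s, by simp⟩⟩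

end

end

/-! ### The abelian category of finitely presented functors and its small model. -/

section

variable {C : Type u} [Category.{w} C] [Preadditive C]

instance : (isFpFunctor C).IsClosedUnderIsomorphisms where
  of_iso := by
    rintro F G e ⟨X, Y, f, ⟨e'⟩⟩
    exact ⟨X, Y, f, ⟨e.symm ≪≫ e'⟩⟩

instance [HasZeroObject C] : (isFpFunctor C).ContainsZero := by
  obtain ⟨Z, hZ⟩ := HasZeroObject.zero (C := C)
  refine ⟨_, ?_, isFpFunctor_coyoneda Z⟩
  exact preadditiveCoyoneda.map_isZero (hZ.op)

section

variable [HasBinaryBiproducts C]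

instance [HasWeakCokernels C] : (isFpFunctor C).IsClosedUnderKernels where
  kernels_le := by
    rintro _ ⟨f, k, hk, hf⟩
    have := Fork.IsLimit.mono hk
    exact isFpFunctor_of_kernel (S := ShortComplex.mk k.ι f k.condition)
      (ShortComplex.exact_of_f_is_kernel _ (IsLimit.ofIsoLimit hk (Fork.ext (Iso.refl _))))
      hf.1 hf.2

instance : (isFpFunctor C).IsClosedUnderCokernels where
  cokernels_le := by
    rintro _ ⟨f, k, hk, hf⟩
    have := Cofork.IsColimit.epi hk
    exact isFpFunctor_of_cokernel (S := ShortComplex.mk f k.π k.condition)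
      (ShortComplex.exact_of_g_is_cokernel _ (IsColimit.ofIsoColimit hk (Cofork.ext (Iso.refl _))))
      hf.1 hf.2

instance : (isFpFunctor C).IsClosedUnderBinaryProducts where
  limitsOfShape_le := by
    rintro F ⟨h⟩
    let e : F ≅ h.diag.obj ⟨.left⟩ ⊞ h.diag.obj ⟨.right⟩ :=
      (IsLimit.postcomposeHomEquiv (diagramIsoPair h.diag) _).symm h.isLimit
        |>.conePointUniqueUpToIso (BinaryBiproduct.isLimit _ _)
    exact (isFpFunctor C).prop_of_iso e.symm
      (isFpFunctor_biprod (h.prop_diag_obj _) (h.prop_diag_obj _))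

instance [HasZeroObject C] : (isFpFunctor C).IsClosedUnderFiniteProducts :=
  .mk'

noncomputable instance [HasZeroObject C] [HasWeakCokernels C] : Abelian (FpFunctor C) :=
  inferInstance

end

instance : LocallySmall.{w} (FpFunctor C) where
  hom_small F G := by
    obtain ⟨_, X, Y, r, x, h⟩ := (isFpFunctor_iff _).1 F.property
    refine small_of_injective (β := G.obj.obj X) (f := fun f ↦ f.hom.app X x) fun f g hfg ↦ ?_
    ext1
    exact h.hom_ext hfg

instance essentiallySmall_fpFunctor [EssentiallySmall.{w} C] :
    EssentiallySmall.{w} (FpFunctor C) := by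
  rw [essentiallySmall_iff]
  refine ⟨?_, inferInstance⟩
  let e := equivSmallModel.{w} C
  let φ (a : Σ (X Y : SmallModel.{w} C), X ⟶ Y) : FpFunctor C :=
    ⟨cokernel (preadditiveCoyoneda.map (e.inverse.map a.2.2).op), _, _, _, ⟨Iso.refl _⟩⟩
  refine small_of_surjective (f := fun a ↦ toSkeleton (φ a)) fun F ↦ ?_
  obtain ⟨X, Y, f, ⟨i⟩⟩ := ((fromSkeleton _).obj F).property
  refine ⟨⟨_, _, e.functor.map f⟩, ?_⟩
  rw [toSkeleton_eq_iff]
  refine ⟨(isFpFunctor C).isoMk (cokernel.mapIso _ (preadditiveCoyoneda.map f.op)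
    (preadditiveCoyoneda.mapIso (e.unitIso.app Y).op)
    (preadditiveCoyoneda.mapIso (e.unitIso.app X).op) ?_ ≪≫ i.symm)⟩
  dsimp
  rw [← preadditiveCoyoneda.map_comp, ← preadditiveCoyoneda.map_comp]
  exact congr(preadditiveCoyoneda.map $(e.unitIso.hom.naturality f).op).symm

variable (C) in
/-- The functor `X ↦ Hom(X, -)`. -/
def coyonedaFp : Cᵒᵖ ⥤ FpFunctor C :=
  ObjectProperty.lift _ preadditiveCoyoneda fun X ↦ isFpFunctor_coyoneda X.unop

instance : (coyonedaFp C).Full := inferInstanceAs (ObjectProperty.lift _ _ _).Full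
instance : (coyonedaFp C).Faithful := inferInstanceAs (ObjectProperty.lift _ _ _).Faithful
instance : (coyonedaFp C).Additive where
  map_add := by
    intros
    ext
    exact Preadditive.add_comp _ _ _ _ _ _

lemma exists_epi_coyonedaFp (F : FpFunctor C) : ∃ (X : C) (p : (coyonedaFp C).obj (op X) ⟶ F),
    Epi p := by
  obtain ⟨_, X, Y, r, x, h⟩ := (isFpFunctor_iff _).1 F.property
  refine ⟨X, ⟨yonedaHom F.obj x⟩, (isFpFunctor C).ι.epi_of_epi_map ?_⟩
  have (Z : C) : Epi ((yonedaHom F.obj x).app Z) := (AddCommGrpCat.epi_iff_surjective _).2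
    fun z ↦ h.exists_map_eq z
  exact NatTrans.epi_of_epi_app (yonedaHom F.obj x)

section

variable [HasBinaryBiproducts C] [HasZeroObject C] [HasWeakCokernels C]

/-- By the Yoneda lemma, since epimorphisms of finitely presented functors are pointwise surjective.
-/
instance (X : Cᵒᵖ) : Projective ((coyonedaFp C).obj X) where
  factors {F G} f p _ := by
    have := (isFpFunctor C).preservesEpimorphisms_ι_of_isNormalMonoCategory
    have : Epi p.hom := inferInstanceAs (Epi ((isFpFunctor C).ι.map p))
    let e := corepresentableByEvaluation X.unop
    obtain ⟨x, hx⟩ := surjective_app_of_epi p.hom X.unop (e.homEquiv f)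
    refine ⟨e.homEquiv.symm x, e.homEquiv.injective ((e.homEquiv_comp p _).trans ?_)⟩
    rw [Equiv.apply_symm_apply]
    exact hx

end

section

variable [EssentiallySmall.{w} C]

variable (C) in
/-- A small model of the opposite of the category of finitely presented functors. -/
abbrev FpModel : Type w := SmallModel.{w} (FpFunctor C)ᵒᵖ

noncomputable instance : Preadditive (FpModel C) :=
  .ofFullyFaithful (equivSmallModel.{w} (FpFunctor C)ᵒᵖ).fullyFaithfulInverse

instance : (equivSmallModel.{w} (FpFunctor C)ᵒᵖ).inverse.Additive :=
  (equivSmallModel.{w} (FpFunctor C)ᵒᵖ).fullyFaithfulInverse.additive_ofFullyFaithful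

instance : (equivSmallModel.{w} (FpFunctor C)ᵒᵖ).functor.Additive :=
  have : (equivSmallModel.{w} (FpFunctor C)ᵒᵖ).symm.functor.Additive :=
    inferInstanceAs (equivSmallModel.{w} (FpFunctor C)ᵒᵖ).inverse.Additive
  (equivSmallModel.{w} (FpFunctor C)ᵒᵖ).symm.inverse_additive

variable (C) in
noncomputable def fpModelEmbedding : C ⥤ FpModel C :=
  (coyonedaFp C).rightOp ⋙ (equivSmallModel.{w} (FpFunctor C)ᵒᵖ).functor

instance : (fpModelEmbedding C).Full := inferInstanceAs (_ ⋙ _).Full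
instance : (fpModelEmbedding C).Faithful := inferInstanceAs (_ ⋙ _).Faithful
instance : (coyonedaFp C).rightOp.Additive where
  map_add := congrArg Quiver.Hom.op (coyonedaFp C).map_add

instance : (fpModelEmbedding C).Additive :=
  inferInstanceAs ((coyonedaFp C).rightOp ⋙ (equivSmallModel.{w} (FpFunctor C)ᵒᵖ).functor).Additive

variable [HasBinaryBiproducts C] [HasZeroObject C] [HasWeakCokernels C]

noncomputable instance : Abelian (FpModel C) :=
  have : HasFiniteProducts (FpModel C) :=
    ⟨fun _ ↦ Adjunction.hasLimitsOfShape_of_equivalence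
      (equivSmallModel.{w} (FpFunctor C)ᵒᵖ).inverse⟩
  abelianOfEquivalence (equivSmallModel.{w} (FpFunctor C)ᵒᵖ).inverse

/-- Dual to the fact that the representables are projective and cover every finitely presented
functor. -/
instance : IsInjectivelyCogenerating (fpModelEmbedding C) where
  injective X := by
    have : Injective (op ((coyonedaFp C).obj (op X))) := inferInstance
    exact ((equivSmallModel.{w} (FpFunctor C)ᵒᵖ).map_injective_iff _).2 this
  exists_mono M := by
    let e := equivSmallModel.{w} (FpFunctor C)ᵒᵖ
    obtain ⟨X, p, _⟩ := exists_epi_coyonedaFp (e.inverse.obj M).unop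
    have : Mono p.op := inferInstance
    let i : e.functor.obj (e.inverse.obj M) ⟶ (fpModelEmbedding C).obj X := e.functor.map p.op
    have : Mono i := e.functor.map_mono p.op
    exact ⟨X, e.counitInv.app M ≫ i, mono_comp _ i⟩

end

end

/-! ### Biproducts and weak cokernels in fp A. -/

section

attribute [local instance] Cardinal.fact_isRegular_aleph0

variable {A : Type u} [Category.{w} A] [Preadditive A]

instance hasZeroObject_fp [HasFiniteBiproducts A] : HasZeroObject (Fp A) := by
  have : HasZeroObject A := hasZeroObject_of_hasFiniteBiproducts A
  obtain ⟨Z, hZ⟩ := HasZeroObject.zero (C := A)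
  have (k : Discrete PEmpty.{1}) : IsCardinalPresentable
      ((Functor.empty.{0} A).obj k) Cardinal.aleph0.{w} := k.as.elim
  have hfp : IsFinitelyPresentable.{w} Z :=
    isCardinalPresentable_of_isColimit _ hZ.isInitial Cardinal.aleph0.{w}
      (by
        rw [hasCardinalLT_aleph0_iff]
        infer_instance)
  refine ⟨⟨Z, hfp⟩, ?_⟩
  rw [IsZero.iff_id_eq_zero]
  ext
  exact hZ.eq_of_src _ _

instance hasBinaryBiproducts_fp [HasBinaryBiproducts A] : HasBinaryBiproducts (Fp A) where
  has_binary_biproduct X Y := by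
    have : IsFinitelyPresentable.{w} X.obj := X.property
    have : IsFinitelyPresentable.{w} Y.obj := Y.property
    let b : BinaryBicone X Y :=
      { pt := ⟨X.obj ⊞ Y.obj, isFinitelyPresentable_biprod _ _⟩
        fst := ObjectProperty.homMk biprod.fst
        snd := ObjectProperty.homMk biprod.snd
        inl := ObjectProperty.homMk biprod.inl
        inr := ObjectProperty.homMk biprod.inr
        inl_fst := by ext; exact biprod.inl_fst
        inl_snd := by ext; exact biprod.inl_snd
        inr_fst := by ext; exact biprod.inr_fst
        inr_snd := by ext; exact biprod.inr_snd }
    exact HasBinaryBiproduct.mk ⟨b, isBinaryBilimitOfTotal b (by ext1; exact biprod.total)⟩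

instance essentiallySmall_fp [IsFinitelyAccessibleCategory.{w} A] : EssentiallySmall.{w} (Fp A) :=
  inferInstance

/-- All morphisms out of `Y` killing `f`, with targets in a small model, assemble into one morphism
to a product. This factors through a stage of a presentation of the product because `Y` is finitely
presentable, and at a later stage the composite with `f` vanishes because `X` is. -/
instance hasWeakCokernels_fp [IsFinitelyAccessibleCategory.{w} A] [HasProducts.{w} A] :
    HasWeakCokernels (Fp A) where
  exists_weakCokernel {X Y} f := by
    have : IsFinitelyPresentable.{w} X.obj := X.property
    have : IsFinitelyPresentable.{w} Y.obj := Y.property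
    let e := equivSmallModel.{w} (Fp A)
    let I := Σ (Z : SmallModel.{w} (Fp A)), { h : Y ⟶ e.inverse.obj Z // f ≫ h = 0 }
    let T (i : I) : A := (e.inverse.obj i.1).obj
    let g₀ : Y.obj ⟶ ∏ᶜ T := Pi.lift fun i ↦ i.2.1.hom
    have hg₀ : f.hom ≫ g₀ = 0 := by
      ext i
      have := congr(($(i.2.2)).hom)
      simpa [g₀] using this
    obtain ⟨J, _, _, p, hp⟩ := exists_presentation_isFinitelyPresentable.{w} (∏ᶜ T)
    obtain ⟨j, g, hg⟩ := IsFinitelyPresentable.exists_hom_of_isColimit p.isColimit g₀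
    obtain ⟨k, a, b, hk⟩ := IsFinitelyPresentable.exists_eq_of_isColimit p.isColimit
      (X := X.obj) (i := j) (j := j) (f.hom ≫ g) (0 : X.obj ⟶ p.diag.obj j) (by
        dsimp at hg ⊢
        rw [Category.assoc, hg, hg₀, zero_comp])
    refine ⟨⟨p.diag.obj k, hp k⟩, ObjectProperty.homMk (g ≫ p.diag.map a), ?_, fun {W} h hh ↦ ?_⟩
    · ext
      dsimp
      rw [← Category.assoc, hk, zero_comp]
    · let h' := h ≫ e.unitIso.hom.app W
      have hh' : f ≫ h' = 0 := by rw [reassoc_of% hh, zero_comp]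
      let π : ∏ᶜ T ⟶ (e.inverse.obj (e.functor.obj W)).obj := Pi.π T ⟨e.functor.obj W, h', hh'⟩
      have hπ : g₀ ≫ π = h'.hom := Pi.lift_π _ _
      let t : (⟨p.diag.obj k, hp k⟩ : Fp A) ⟶ e.inverse.obj (e.functor.obj W) :=
        ObjectProperty.homMk (p.ι.app k ≫ π)
      refine ⟨t ≫ e.unitIso.inv.app W, ?_⟩
      have : ObjectProperty.homMk (g ≫ p.diag.map a) ≫ t = h' := by
        ext
        dsimp [t] at hg ⊢
        rw [← hπ, ← hg, Category.assoc, Category.assoc, p.w_assoc]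
      rw [← Category.assoc, this]
      simp [h']

end

/-! ### The evaluation functor and filtered colimits. -/

section

attribute [local instance] Cardinal.fact_isRegular_aleph0

section

variable {A : Type u} [Category.{w} A] {H : Type u₂} [Category.{v₂} H]

lemma hom_ext_of_isPointwiseLeftKanExtension {F : Fp A ⥤ H} {G : A ⥤ H}
    (η : F ⟶ (ObjectProperty.isFinitelyPresentable.{w} A).ι ⋙ G)
    (hG : (Functor.LeftExtension.mk G η).IsPointwiseLeftKanExtension) {X : A} {Y : H}
    {f g : G.obj X ⟶ Y} (h : ∀ (Z : Fp A) (t : Z.obj ⟶ X),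
      (η.app Z : F.obj Z ⟶ G.obj Z.obj) ≫ G.map t ≫ f = η.app Z ≫ G.map t ≫ g) : f = g :=
  (hG X).hom_ext fun T ↦
    (Category.assoc _ _ _).trans ((h T.left T.hom).trans (Category.assoc _ _ _).symm)

lemma exists_desc_of_isPointwiseLeftKanExtension {F : Fp A ⥤ H} {G : A ⥤ H}
    (η : F ⟶ (ObjectProperty.isFinitelyPresentable.{w} A).ι ⋙ G)
    (hG : (Functor.LeftExtension.mk G η).IsPointwiseLeftKanExtension) {X : A} {Y : H}
    (φ : ∀ (Z : Fp A) (_ : Z.obj ⟶ X), F.obj Z ⟶ Y)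
    (hφ : ∀ (Z Z' : Fp A) (a : Z ⟶ Z') (t : Z'.obj ⟶ X),
      F.map a ≫ φ Z' t = φ Z (a.hom ≫ t)) :
    ∃ d : G.obj X ⟶ Y, ∀ (Z : Fp A) (t : Z.obj ⟶ X),
      (η.app Z : F.obj Z ⟶ G.obj Z.obj) ≫ G.map t ≫ d = φ Z t := by
  let c : Cocone (CostructuredArrow.proj (ObjectProperty.isFinitelyPresentable.{w} A).ι X ⋙ F) :=
    ⟨Y,
      { app := fun T ↦ φ T.left T.hom
        naturality := fun T T' a ↦
          (hφ _ _ a.left T'.hom).trans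
            ((congrArg (φ T.left) (CostructuredArrow.w a)).trans (Category.comp_id _).symm) }⟩
  exact ⟨(hG X).desc c, fun Z t ↦
    (Category.assoc _ _ _).symm.trans ((hG X).fac c (CostructuredArrow.mk t))⟩

/-- A pointwise left Kan extension along the inclusion of the finitely presented objects commutes
with filtered colimits. -/
lemma preservesColimit_of_isPointwiseLeftKanExtension {F : Fp A ⥤ H} {G : A ⥤ H}
    (η : F ⟶ (ObjectProperty.isFinitelyPresentable.{w} A).ι ⋙ G)
    (hG : (Functor.LeftExtension.mk G η).IsPointwiseLeftKanExtension)
    {J : Type w} [SmallCategory J] [IsFiltered J] (D : J ⥤ A) : PreservesColimit D G where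
  preserves {c} hc := by
    have hfp (Z : Fp A) : IsFinitelyPresentable.{w} Z.obj := Z.property
    refine ⟨IsColimit.ofExistsUnique fun s ↦ ?_⟩
    have hs {j k : J} (a : j ⟶ k) : G.map (D.map a) ≫ s.ι.app k = s.ι.app j := s.w a
    have hex (Z : Fp A) (t : Z.obj ⟶ c.pt) : ∃ (j : J) (z : Z.obj ⟶ D.obj j),
        z ≫ c.ι.app j = t := IsFinitelyPresentable.exists_hom_of_isColimit hc t
    choose j z hz using hex
    let e (Z : Fp A) : F.obj Z ⟶ G.obj Z.obj := η.app Z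
    have he {Z Z' : Fp A} (a : Z ⟶ Z') : F.map a ≫ e Z' = e Z ≫ G.map a.hom := η.naturality a
    -- Factorizations through a stage are chosen arbitrarily; any two agree at a later stage, so the
    -- choices do not affect the cocone.
    have huniq {Z : Fp A} {j k : J} (a : Z.obj ⟶ D.obj j) (b : Z.obj ⟶ D.obj k)
        (hab : a ≫ c.ι.app j = b ≫ c.ι.app k) :
        e Z ≫ G.map a ≫ s.ι.app j = e Z ≫ G.map b ≫ s.ι.app k := by
      obtain ⟨l, p, q, h⟩ := IsFinitelyPresentable.exists_eq_of_isColimit hc a b hab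
      rw [← hs p, ← hs q, ← G.map_comp_assoc, ← G.map_comp_assoc, h]
    obtain ⟨d, hd⟩ := exists_desc_of_isPointwiseLeftKanExtension η hG
      (fun Z t ↦ e Z ≫ G.map (z Z t) ≫ s.ι.app (j Z t)) (fun Z Z' a t ↦ by
        rw [reassoc_of% (he a), ← G.map_comp_assoc]
        apply huniq
        rw [Category.assoc, hz, hz])
    refine ⟨d, fun k ↦ hom_ext_of_isPointwiseLeftKanExtension η hG fun Z t ↦ ?_, fun m hm ↦
      hom_ext_of_isPointwiseLeftKanExtension η hG fun Z t ↦ ?_⟩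
    · have h := hd Z (t ≫ c.ι.app k)
      rw [G.map_comp, Category.assoc] at h
      refine h.trans (huniq _ _ (hz _ _))
    · have h : G.map t ≫ m = G.map (z Z t) ≫ s.ι.app (j Z t) := by
        refine (congrArg (G.map · ≫ m) (hz Z t).symm).trans ?_
        rw [G.map_comp, Category.assoc]
        exact congrArg (G.map (z Z t) ≫ ·) (hm _)
      rw [hd, h]

end

variable (A : Type u) [Category.{w} A] [Preadditive A] [IsFinitelyAccessibleCategory.{w} A]

instance : PreservesFilteredColimitsOfSize.{w, w} (extendedEvaluation A) where
  preserves_filtered_colimits J _ _ := by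
    refine preservesColimitsOfShape_of_evaluation _ _ fun F ↦ ⟨fun {D} ↦ ?_⟩
    exact preservesColimit_of_isPointwiseLeftKanExtension _
      (Functor.isPointwiseLeftKanExtensionLeftKanExtensionUnit
        (ObjectProperty.isFinitelyPresentable.{w} A).ι F.obj) D

instance : PreservesFilteredColimitsOfSize.{w, w} (ev A) where
  preserves_filtered_colimits J _ _ := by
    have : PreservesColimitsOfShape J (ev A ⋙ ObjectProperty.ι _) :=
      inferInstanceAs (PreservesColimitsOfShape J (extendedEvaluation A))
    exact preservesColimitsOfShape_of_reflects_of_preserves (ev A) (ObjectProperty.ι _)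

/-- On finitely presented objects, `extendedEvaluation` is evaluation. -/
noncomputable def ιCompExtendedEvaluation :
    (ObjectProperty.isFinitelyPresentable.{w} A).ι ⋙ extendedEvaluation A ≅
      (isFpFunctor (Fp A)).ι.flip :=
  ((flipFunctor _ _ _).mapIso (Functor.isoWhiskerLeft (isFpFunctor (Fp A)).ι
    (asIso ((ObjectProperty.isFinitelyPresentable.{w} A).ι.lanUnit (H := AddCommGrpCat.{w}))))).symm

end

/-! ### The purity category as a category of ind-objects. -/

section

/-- Precomposition with an equivalence, on left exact functors. -/
lemma isEquivalence_leftExact_whiskeringLeft {D : Type u₁} [Category.{v₁} D] {D' : Type u₂}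
    [Category.{v₂} D'] (H : Type u₃) [Category.{v₃} H] (δ : D ⥤ₗ D') [δ.obj.IsEquivalence] :
    ((LeftExactFunctor.whiskeringLeft D D' H).obj δ).IsEquivalence := by
  have h : ((LeftExactFunctor.whiskeringLeft D D' H).obj δ).FullyFaithful :=
    Functor.FullyFaithful.ofCompFaithful (G := ObjectProperty.ι _)
      ((ObjectProperty.fullyFaithfulι _).comp
        (Functor.FullyFaithful.ofFullyFaithful ((Functor.whiskeringLeft D D' H).obj δ.obj)))
  have : ((LeftExactFunctor.whiskeringLeft D D' H).obj δ).EssSurj := ⟨fun N ↦ by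
    have := N.property
    have : PreservesFiniteLimits N.obj := this
    exact ⟨⟨δ.obj.inv ⋙ N.obj, comp_preservesFiniteLimits _ _⟩, ⟨ObjectProperty.isoMk _
      ((Functor.associator _ _ _).symm ≪≫
        Functor.isoWhiskerRight δ.obj.asEquivalence.unitIso.symm N.obj ≪≫
          Functor.leftUnitor _)⟩⟩⟩
  have := h.full
  have := h.faithful
  exact {}

variable {C : Type u} [Category.{w} C] [Preadditive C] [EssentiallySmall.{w} C]
  [HasBinaryBiproducts C] [HasZeroObject C] [HasWeakCokernels C]

variable (C) in
/-- The equivalence between the opposite of the small model and finitely presented functors. -/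
noncomputable def fpModelOpToFpFunctor : (FpModel C)ᵒᵖ ⥤ FpFunctor C :=
  (equivSmallModel.{w} (FpFunctor C)ᵒᵖ).inverse.leftOp

instance : (fpModelOpToFpFunctor C).IsEquivalence :=
  inferInstanceAs (equivSmallModel.{w} (FpFunctor C)ᵒᵖ).inverse.leftOp.IsEquivalence

instance : HasFiniteBiproducts (FpModel C)ᵒᵖ := HasFiniteBiproducts.of_hasFiniteProducts

variable (C) in
/-- Left exact functors on finitely presented functors, as left exact functors on the opposite of
the small model. -/
noncomputable def restrictToFpModel :
    (FpFunctor C ⥤ₗ AddCommGrpCat.{w}) ⥤ ((FpModel C)ᵒᵖ ⥤ₗ AddCommGrpCat.{w}) :=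
  (LeftExactFunctor.whiskeringLeft (FpModel C)ᵒᵖ (FpFunctor C) AddCommGrpCat.{w}).obj
      ⟨fpModelOpToFpFunctor C, (inferInstance : PreservesFiniteLimits (fpModelOpToFpFunctor C))⟩

instance : (restrictToFpModel C).IsEquivalence :=
  isEquivalence_leftExact_whiskeringLeft AddCommGrpCat.{w} (D := (FpModel C)ᵒᵖ)
      ⟨fpModelOpToFpFunctor C, (inferInstance : PreservesFiniteLimits (fpModelOpToFpFunctor C))⟩

variable (C) in
/-- Left exact functors on finitely presented functors, as ind-objects of the small model. -/
noncomputable def leftExactToInd : (FpFunctor C ⥤ₗ AddCommGrpCat.{w}) ⥤ Ind (FpModel C) :=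
  restrictToFpModel C ⋙
    (AddCommGrpCat.leftExactFunctorForgetEquivalence (FpModel C)ᵒᵖ).functor ⋙
      (Ind.leftExactFunctorEquivalence (FpModel C)).inverse

instance : (leftExactToInd C).IsEquivalence :=
  inferInstanceAs (restrictToFpModel C ⋙
    (AddCommGrpCat.leftExactFunctorForgetEquivalence (FpModel C)ᵒᵖ).functor ⋙
      (Ind.leftExactFunctorEquivalence (FpModel C)).inverse).IsEquivalence

variable (C) in
/-- The underlying presheaf of `leftExactToInd`. -/
noncomputable def leftExactToIndCompInclusion :
    leftExactToInd C ⋙ Ind.inclusion (FpModel C) ≅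
      ObjectProperty.ι _ ⋙ (Functor.whiskeringLeft (FpModel C)ᵒᵖ (FpFunctor C) _).obj
        (fpModelOpToFpFunctor C) ⋙
        (Functor.whiskeringRight (FpModel C)ᵒᵖ _ _).obj (forget AddCommGrpCat.{w}) :=
  Functor.isoWhiskerLeft (restrictToFpModel C ⋙
    (AddCommGrpCat.leftExactFunctorForgetEquivalence (FpModel C)ᵒᵖ).functor)
    (Functor.isoWhiskerRight (Ind.leftExactFunctorEquivalence (FpModel C)).counitIso
      (ObjectProperty.ι _))

variable (C) in
/-- Evaluation, as a presheaf on the small model, is represented by the image of the object. -/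
noncomputable def fpModelEmbeddingCompYoneda :
    fpModelEmbedding C ⋙ yoneda ≅ (isFpFunctor C).ι.flip ⋙
      (Functor.whiskeringLeft _ _ _).obj (fpModelOpToFpFunctor C) ⋙
        (Functor.whiskeringRight _ _ _).obj (forget AddCommGrpCat.{w}) :=
  let adj := (equivSmallModel.{w} (FpFunctor C)ᵒᵖ).symm.toAdjunction
  let r (X : C) := corepresentableByEvaluation X
  NatIso.ofComponents (fun X ↦ NatIso.ofComponents (fun G ↦
      Equiv.toIso (((adj.homEquiv G.unop (op ((coyonedaFp C).obj (op X)))).symm.trans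
        (opEquiv _ _)).trans (r X).homEquiv))
    (fun a ↦ by
      ext f
      have h := adj.homEquiv_naturality_left_symm a.unop (f : _ ⟶ (fpModelEmbedding C).obj X)
      exact (congrArg (fun t ↦ (r X).homEquiv (Quiver.Hom.unop t)) h).trans
        ((r X).homEquiv_comp _ _)))
    (fun {X Y} f ↦ by
      ext G g
      have h := adj.homEquiv_naturality_right_symm
        (g : G.unop ⟶ (fpModelEmbedding C).obj X) ((coyonedaFp C).map f.op).op
      refine (congrArg (fun t ↦ (r Y).homEquiv (Quiver.Hom.unop t)) h).trans ?_
      let φ : (coyonedaFp C).obj (op X) ⟶ (fpModelOpToFpFunctor C).obj G :=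
        ((adj.homEquiv G.unop (op ((coyonedaFp C).obj (op X)))).symm
          (g : G.unop ⟶ (fpModelEmbedding C).obj X)).unop
      exact congr(φ.hom.app Y $((Category.comp_id f).trans (Category.id_comp f).symm)).trans
        congr($(φ.hom.naturality f) (𝟙 X)))

omit [HasBinaryBiproducts C] [HasZeroObject C] [HasWeakCokernels C] in
/-- Corepresentability on finitely presented functors in terms of the small model. -/
lemma nonempty_corepresentableBy_iff_representableBy (H : FpFunctor C ⥤ Type w) (F : FpFunctor C) :
    Nonempty (H.CorepresentableBy F) ↔ Nonempty ((fpModelOpToFpFunctor C ⋙ H).RepresentableBy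
      ((equivSmallModel.{w} (FpFunctor C)ᵒᵖ).functor.obj (op F))) := by
  let e := equivSmallModel.{w} (FpFunctor C)ᵒᵖ
  refine ⟨fun ⟨r⟩ ↦ ⟨
    { homEquiv {G} := ((e.symm.toAdjunction.homEquiv G (op F)).symm.trans (opEquiv _ _)).trans
        r.homEquiv
      homEquiv_comp {G G'} a f := ?_ }⟩, fun ⟨r⟩ ↦ ⟨
    { homEquiv {G} := ((opEquiv (op G) (op F)).symm.trans e.fullyFaithfulFunctor.homEquiv).trans
        (r.homEquiv.trans (H.mapIso (e.unitIso.app (op G)).unop).toEquiv)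
      homEquiv_comp {G G'} a f := ?_ }⟩⟩
  · have h := e.symm.toAdjunction.homEquiv_naturality_left_symm a f
    refine (congrArg (fun t ↦ r.homEquiv (Quiver.Hom.unop t)) h).trans ?_
    exact r.homEquiv_comp _ _
  · have h : e.functor.map (f ≫ a).op = e.functor.map a.op ≫ e.functor.map f.op := by simp
    refine (congrArg (fun t ↦ H.map (e.unitIso.app (op G')).unop.hom (r.homEquiv t)) h).trans ?_
    refine (congrArg (H.map (e.unitIso.app (op G')).unop.hom) (r.homEquiv_comp _ _)).trans ?_
    have h' : ((e.inverse.map (e.functor.map a.op)).unop ≫ (e.unitIso.hom.app (op G')).unop) =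
        (e.unitIso.hom.app (op G)).unop ≫ a :=
      congrArg Quiver.Hom.unop (e.unitIso.hom.naturality a.op).symm
    refine (congr($(H.map_comp _ _) _)).symm.trans (Eq.trans ?_ (congr($(H.map_comp _ _) _)))
    exact congr(H.map $h' _)

lemma nonempty_corepresentableBy_iff (N : FpFunctor C ⥤ₗ AddCommGrpCat.{w}) (F : FpFunctor C) :
    Nonempty ((N.obj ⋙ forget AddCommGrpCat.{w}).CorepresentableBy F) ↔
      Nonempty (Ind.yoneda.obj ((equivSmallModel.{w} (FpFunctor C)ᵒᵖ).functor.obj (op F)) ≅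
        (leftExactToInd C).obj N) := by
  rw [nonempty_corepresentableBy_iff_representableBy,
    Functor.representableByEquiv.nonempty_congr]
  let e₁ := Ind.yonedaCompInclusion.app ((equivSmallModel.{w} (FpFunctor C)ᵒᵖ).functor.obj (op F))
  let e₂ := (leftExactToIndCompInclusion C).app N
  exact ⟨fun ⟨i⟩ ↦ ⟨(Ind.inclusion (FpModel C)).preimageIso (e₁ ≪≫ i ≪≫ e₂.symm)⟩,
    fun ⟨i⟩ ↦ ⟨e₁.symm ≪≫ (Ind.inclusion (FpModel C)).mapIso i ≪≫ e₂⟩⟩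

end

/-! ### The abelian structure on P(A), and S_E as a class of ind-objects. -/

section

section

variable {C : Type u} [Category.{w} C] [Preadditive C] [EssentiallySmall.{w} C]
  [HasBinaryBiproducts C] [HasZeroObject C] [HasWeakCokernels C]

instance : HasFiniteProducts (FpFunctor C ⥤ₗ AddCommGrpCat.{w}) :=
  ⟨fun _ ↦ Adjunction.hasLimitsOfShape_of_equivalence (leftExactToInd C)⟩

noncomputable instance abelian_leftExact : Abelian (FpFunctor C ⥤ₗ AddCommGrpCat.{w}) :=
  abelianOfEquivalence (leftExactToInd C)

instance isGrothendieckAbelian_leftExact :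
    IsGrothendieckAbelian.{w} (FpFunctor C ⥤ₗ AddCommGrpCat.{w}) :=
  IsGrothendieckAbelian.of_equivalence (leftExactToInd C).asEquivalence.symm

/-- The kernels of the images of admissible monomorphisms in the small model correspond to the
cokernels of the morphisms they induce between representable functors. -/
lemma kernels_fpModelEmbedding_iff (E : ExactStructure C) (F : FpFunctor C) :
    E.kernels (fpModelEmbedding C) ((equivSmallModel.{w} (FpFunctor C)ᵒᵖ).functor.obj (op F)) ↔
      ∃ (X Y : C) (f : X ⟶ Y), IsAdmissibleMono E.conflation f ∧
        Nonempty (F.obj ≅ cokernel (preadditiveCoyoneda.map f.op)) := by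
  let e := equivSmallModel.{w} (FpFunctor C)ᵒᵖ
  refine exists_congr fun X ↦ exists_congr fun Y ↦ exists_congr fun f ↦
    and_congr_right fun _ ↦ ?_
  have := (isFpFunctor C).preservesCokernels_ι
  let i : kernel ((fpModelEmbedding C).map f) ≅
      e.functor.obj (op (cokernel ((coyonedaFp C).map f.op))) :=
    (PreservesKernel.iso e.functor ((coyonedaFp C).map f.op).op).symm ≪≫
      e.functor.mapIso (kernelOpOp _)
  let j : (cokernel ((coyonedaFp C).map f.op)).obj ≅ cokernel (preadditiveCoyoneda.map f.op) :=
    PreservesCokernel.iso (isFpFunctor C).ι ((coyonedaFp C).map f.op)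
  exact ⟨fun ⟨a⟩ ↦ ⟨(isFpFunctor C).ι.mapIso (e.functor.preimageIso (a ≪≫ i)).unop.symm ≪≫ j⟩,
    fun ⟨a⟩ ↦ ⟨e.functor.mapIso ((isFpFunctor C).isoMk (a ≪≫ j.symm)).symm.op ≪≫ i.symm⟩⟩

end

variable (A : Type u) [Category.{w} A] [Preadditive A] [HasFiniteBiproducts A]
    [IsFinitelyAccessibleCategory.{w} A] [HasProducts.{w} A]

section

variable [HasBinaryBiproducts A]

/-- On finitely presented objects, `ev` is representable. -/
noncomputable def ιCompEvCompLeftExactToInd :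
    (ObjectProperty.isFinitelyPresentable.{w} A).ι ⋙ ev A ⋙ leftExactToInd (Fp A) ≅
      fpModelEmbedding (Fp A) ⋙ Ind.yoneda :=
  (Ind.inclusion.fullyFaithful.whiskeringRight _).preimageIso
    (Functor.isoWhiskerLeft ((ObjectProperty.isFinitelyPresentable.{w} A).ι ⋙ ev A)
        (leftExactToIndCompInclusion (Fp A)) ≪≫
      Functor.isoWhiskerRight (ιCompExtendedEvaluation A)
        ((Functor.whiskeringLeft (FpModel (Fp A))ᵒᵖ (FpFunctor (Fp A)) _).obj
          (fpModelOpToFpFunctor (Fp A)) ⋙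
            (Functor.whiskeringRight (FpModel (Fp A))ᵒᵖ _ _).obj (forget AddCommGrpCat.{w})) ≪≫
      (fpModelEmbeddingCompYoneda (Fp A)).symm ≪≫
      Functor.isoWhiskerLeft (fpModelEmbedding (Fp A)) Ind.yonedaCompInclusion.symm)

end

variable {A} [HasBinaryBiproducts A] (E : ExactStructure (Fp A))

lemma corepresentedBySerreClass_eq :
    corepresentedBySerreClass E =
      (indYonedaImage (E.kernels (fpModelEmbedding (Fp A)))).inverseImage
        (leftExactToInd (Fp A)) := by
  ext N
  refine ⟨?_, ?_⟩
  · rintro ⟨F, hF, h⟩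
    exact ⟨_, (kernels_fpModelEmbedding_iff E F).2 hF, (nonempty_corepresentableBy_iff N F).1 h⟩
  · rintro ⟨G, hG, ⟨i⟩⟩
    let e := equivSmallModel.{w} (FpFunctor (Fp A))ᵒᵖ
    let a : G ≅ e.functor.obj (op (e.inverse.obj G).unop) := (e.counitIso.app G).symm
    refine ⟨(e.inverse.obj G).unop, (kernels_fpModelEmbedding_iff E _).1 ?_,
      (nonempty_corepresentableBy_iff N _).2 ⟨Ind.yoneda.mapIso a.symm ≪≫ i⟩⟩
    obtain ⟨X, Y, f, hf, ⟨b⟩⟩ := hG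
    exact ⟨X, Y, f, hf, ⟨a.symm ≪≫ b⟩⟩

end

/-! ### Torsion classes as kernels, and transport along equivalences. -/

section

section Torsion

variable {P : Type u₁} [Category.{v₁} P] [Abelian P] {B : Type u₂} [Category.{v₂} B] [Abelian B]

lemma isoModTorsion_eq (T : ObjectProperty P) [T.IsSerreClass] :
    isoModTorsion T = T.isoModSerre := by
  ext X Y f
  refine ⟨?_, fun h ↦ ⟨⟨_, ⟨kernelIsKernel f⟩, h.1⟩, ⟨_, ⟨cokernelIsCokernel f⟩, h.2⟩⟩⟩
  rintro ⟨⟨k, ⟨hk⟩, h⟩, ⟨c, ⟨hc⟩, h'⟩⟩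
  exact ⟨T.prop_of_iso (hk.conePointUniqueUpToIso (limit.isLimit _)) h,
    T.prop_of_iso (hc.coconePointUniqueUpToIso (colimit.isColimit _)) h'⟩

/-- A torsion class generated under filtered colimits by finitely presented objects has a
torsion-free class which is closed under filtered colimits. -/
lemma isClosedUnderColimitsOfShape_torsionFree_ind (S : ObjectProperty P)
    (hS : S ≤ ObjectProperty.isFinitelyPresentable.{w} P) (J : Type w) [SmallCategory J]
    [IsFiltered J] : (torsionFree (ObjectProperty.ind.{w} S)).IsClosedUnderColimitsOfShape J where
  colimitsOfShape_le := by
    rintro Y ⟨p⟩ X ⟨I, _, _, q, hq⟩ f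
    refine q.isColimit.hom_ext fun i ↦ ?_
    have : IsFinitelyPresentable.{w} (q.diag.obj i) := hS _ (hq i)
    obtain ⟨j, g, hg⟩ := IsFinitelyPresentable.exists_hom_of_isColimit p.isColimit
      (q.ι.app i ≫ f)
    have hg0 : g = 0 := p.prop_diag_obj j _ (ObjectProperty.le_ind _ _ (hq i)) g
    dsimp at hg ⊢
    rw [← hg, hg0, zero_comp, comp_zero]

/-- The kernel of an exact functor with a fully faithful right adjoint is the torsion class of a
torsion pair. -/
lemma isHereditaryTorsionClassOfFiniteType_kernel {q : P ⥤ B} {s : B ⥤ P} (adj : q ⊣ s) [s.Full]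
    [s.Faithful] [PreservesFiniteLimits q] (S : ObjectProperty P)
    (hS : S ≤ ObjectProperty.isFinitelyPresentable.{w} P)
    (h : q.kernel = ObjectProperty.ind.{w} S) :
    IsHereditaryTorsionClassOfFiniteType.{w} q.kernel where
  isClosedUnderIsomorphisms := inferInstance
  exists_shortExact X := by
    -- The unit is inverted by `q`, so its kernel is torsion; its coimage embeds into `s.obj (q.obj
    -- X)`, which is torsion-free by adjunction.
    let η := adj.unit.app X
    have := adj.isLeftAdjoint
    have hη : IsIso (q.map η) := inferInstance
    refine ⟨kernel η, Abelian.coimage η, kernel.ι η, Abelian.coimage.π η, cokernel.condition _,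
      .mk' (ShortComplex.exact_cokernel _) inferInstance inferInstance, ?_, fun Z hZ f ↦ ?_⟩
    · change IsZero _
      have : q.map (kernel.ι η) = 0 := by
        rw [← cancel_mono (q.map η), ← q.map_comp, kernel.condition, zero_comp, q.map_zero]
      exact IsZero.of_mono_eq_zero _ this
    · rw [← cancel_mono (Abelian.factorThruCoimage η), zero_comp]
      apply (adj.homEquiv _ _).symm.injective
      exact IsZero.eq_of_src hZ _ _
  isClosedUnderSubobjects := inferInstance
  isClosedUnderFilteredColimits J _ _ := by
    rw [h]
    exact isClosedUnderColimitsOfShape_torsionFree_ind S hS J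

end Torsion

section Transport

variable {A : Type u} [Category.{w} A] [Preadditive A] {B : Type u₁} [Category.{v₁} B] [Abelian B]
  {B' : Type u₂} [Category.{v₂} B']

/-- An equivalence to an abelian category transports the abelian structure, and with it properties
of functors. -/
lemma exists_abelian_of_equivalence [IsGrothendieckAbelian.{w} B] (e : B' ≌ B) {Φ : A ⥤ B}
    {Φ' : A ⥤ B'} (i : Φ' ⋙ e.functor ≅ Φ) [Φ.Full] [Φ.Faithful] [Φ.Additive]
    [PreservesFilteredColimitsOfSize.{w, w} Φ]
    (hcok : ∀ {X Y : A} (f : X ⟶ Y), PreservesColimit (parallelPair f 0) Φ)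
    (hext : ∀ S : ShortComplex B, S.ShortExact → Φ.essImage S.X₁ → Φ.essImage S.X₃ →
        Φ.essImage S.X₂) :
    ∃ _ : Abelian B', IsGrothendieckAbelian.{w} B' ∧ Φ'.Additive ∧ Φ'.Full ∧ Φ'.Faithful ∧
      PreservesFilteredColimitsOfSize.{w, w} Φ' ∧
      (∀ {X Y : A} (f : X ⟶ Y), PreservesColimit (parallelPair f 0) Φ') ∧
      (∀ S : ShortComplex B', S.ShortExact → Φ'.essImage S.X₁ → Φ'.essImage S.X₃ →
        Φ'.essImage S.X₂) := by
  let j : Φ ⋙ e.inverse ≅ Φ' :=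
    (Functor.isoWhiskerRight i e.inverse).symm ≪≫ Functor.associator _ _ _ ≪≫
      Functor.isoWhiskerLeft Φ' e.unitIso.symm ≪≫ Functor.rightUnitor _
  let _ : Preadditive B' := .ofFullyFaithful e.fullyFaithfulFunctor
  have : e.functor.Additive := e.fullyFaithfulFunctor.additive_ofFullyFaithful
  have : HasFiniteProducts B' :=
    ⟨fun _ ↦ Adjunction.hasLimitsOfShape_of_equivalence e.functor⟩
  let _ : Abelian B' := abelianOfEquivalence e.functor
  have hess (X : B') : Φ'.essImage X ↔ Φ.essImage (e.functor.obj X) :=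
    ⟨fun ⟨Y, ⟨a⟩⟩ ↦ ⟨Y, ⟨i.symm.app Y ≪≫ e.functor.mapIso a⟩⟩,
      fun ⟨Y, ⟨a⟩⟩ ↦ ⟨Y, ⟨j.symm.app Y ≪≫ e.inverse.mapIso a ≪≫ (e.unitIso.app X).symm⟩⟩⟩
  have : e.inverse.Additive := e.inverse_additive
  refine ⟨inferInstance, .of_equivalence e.symm, Functor.additive_of_iso j, Functor.Full.of_iso j,
    Functor.Faithful.of_iso j, ⟨fun J _ _ ↦ preservesColimitsOfShape_of_natIso j⟩, fun f ↦ ?_,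
    fun S hS h₁ h₃ ↦ ?_⟩
  · have := hcok f
    exact preservesColimit_of_natIso _ j
  · exact (hess _).2 (hext (S.map e.functor) (hS.map_of_exact e.functor) ((hess _).1 h₁)
      ((hess _).1 h₃))

end Transport

end

/-! ### The relative purity category as ind-objects of the quotient. -/

section

attribute [local instance] Cardinal.fact_isRegular_aleph0

variable {A : Type u} [Category.{w} A] [Preadditive A] [HasFiniteBiproducts A]
    [IsFinitelyAccessibleCategory.{w} A] [HasProducts.{w} A] [HasBinaryBiproducts A]
    (E : ExactStructure (Fp A))

instance (K : Type w) [SmallCategory K] [Abelian K] (S : ObjectProperty K) :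
    (indYonedaImage S).IsClosedUnderIsomorphisms where
  of_iso := by
    rintro N N' e ⟨G, hG, ⟨i⟩⟩
    exact ⟨G, hG, ⟨i ≪≫ e⟩⟩

lemma corepresentedBySerreClass_le :
    corepresentedBySerreClass E ≤ ObjectProperty.isFinitelyPresentable.{w} (PurityCategory A) := by
  rw [corepresentedBySerreClass_eq]
  rintro N ⟨G, -, ⟨i⟩⟩
  have := isFinitelyPresentable_indYoneda G
  have := isCardinalPresentable_of_iso i Cardinal.aleph0.{w}
  exact (isCardinalPresentable_iff_of_isEquivalence N Cardinal.aleph0.{w}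
    (leftExactToInd (Fp A))).1 this

section

variable {K' : Type w} [SmallCategory K'] [Abelian K'] (L : FpModel (Fp A) ⥤ K')
  [PreservesFiniteColimits L]

/-- The functor from the purity category to ind-objects of a localization of the small model. -/
noncomputable def purityToInd : PurityCategory A ⥤ Ind K' :=
  leftExactToInd (Fp A) ⋙ indExtension L

/-- The right adjoint of `purityToInd`. -/
noncomputable def indToPurity : Ind K' ⥤ PurityCategory A :=
  indRestriction L ⋙ (leftExactToInd (Fp A)).inv

noncomputable def purityAdjunction : purityToInd L ⊣ indToPurity (A := A) L :=
  (leftExactToInd (Fp A)).asEquivalence.toAdjunction.comp (indAdjunction L)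

instance : PreservesColimitsOfSize.{w, w} (purityToInd (A := A) L) :=
  (purityAdjunction L).leftAdjoint_preservesColimits

instance : PreservesFiniteColimits (purityToInd (A := A) L) :=
  comp_preservesFiniteColimits _ _

instance [PreservesFiniteLimits L] : PreservesFiniteLimits (purityToInd (A := A) L) :=
  comp_preservesFiniteLimits _ _

variable [L.IsLocalization (E.kernels (fpModelEmbedding (Fp A))).isoModSerre]

lemma torsionClass_eq_kernel : torsionClass E = (purityToInd L).kernel := by
  have h := kernel_indExtension L (E.kernels (fpModelEmbedding (Fp A)))
  rw [torsionClass, corepresentedBySerreClass_eq,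
    ObjectProperty.ind_inverseImage_eq_of_isEquivalence, ← h]
  rfl

include E in
lemma fullyFaithful_indToPurity : Nonempty (indToPurity (A := A) L).FullyFaithful := by
  obtain ⟨h⟩ := fullyFaithful_indRestriction L (E.kernels (fpModelEmbedding (Fp A)))
  exact ⟨h.comp (.ofFullyFaithful (leftExactToInd (Fp A)).inv)⟩

variable [PreservesFiniteLimits L]

include L in
lemma isHereditaryTorsionClassOfFiniteType_torsionClass_of_isLocalization :
    IsHereditaryTorsionClassOfFiniteType.{w} (torsionClass E) := by
  obtain ⟨h⟩ := fullyFaithful_indToPurity E L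
  have := h.full
  have := h.faithful
  have := isHereditaryTorsionClassOfFiniteType_kernel (purityAdjunction L)
    (corepresentedBySerreClass E) (corepresentedBySerreClass_le E)
    (torsionClass_eq_kernel E L).symm
  rwa [← torsionClass_eq_kernel E L] at this

/-- An exact functor with a fully faithful right adjoint is the localisation at its kernel, here
T_E. -/
lemma isLocalization_purityToInd :
    (purityToInd L).IsLocalization (isoModTorsion (torsionClass E)) := by
  obtain ⟨h⟩ := fullyFaithful_indToPurity E L
  have := h.full
  have := h.faithful
  rw [torsionClass_eq_kernel E L, isoModTorsion_eq]
  exact Abelian.isLocalization_isoModSerre_kernel_of_leftAdjoint (purityAdjunction L)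

/-- On finitely presented objects, `ev A ⋙ purityToInd L` is representable. -/
noncomputable def ιCompEvCompPurityToInd :
    (ObjectProperty.isFinitelyPresentable.{w} A).ι ⋙ ev A ⋙ purityToInd L ≅
      fpModelEmbedding (Fp A) ⋙ L ⋙ Ind.yoneda :=
  Functor.isoWhiskerRight (ιCompEvCompLeftExactToInd A) (indExtension L) ≪≫
    Functor.isoWhiskerLeft (fpModelEmbedding (Fp A)) (yonedaCompIndExtension L)

end

end

end RelativePurity

theorem theorem2p5 {A : Type u} [Category.{w} A] [Preadditive A] [HasFiniteBiproducts A]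
    [IsFinitelyAccessibleCategory.{w} A] [HasProducts.{w} A]
    (E : RelativePurity.ExactStructure (RelativePurity.Fp A)) :
    (∃ _ : Abelian (RelativePurity.PurityCategory A),
      IsGrothendieckAbelian.{w} (RelativePurity.PurityCategory A)) ∧
    RelativePurity.IsHereditaryTorsionClassOfFiniteType.{w} (RelativePurity.torsionClass E) ∧
    ∃ _ : Abelian (RelativePurity.RelativePurityCategory E),
      IsGrothendieckAbelian.{w} (RelativePurity.RelativePurityCategory E) ∧
      (RelativePurity.evRelative E).Additive ∧
      (RelativePurity.evRelative E).Full ∧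
      (RelativePurity.evRelative E).Faithful ∧
      PreservesFilteredColimitsOfSize.{w, w} (RelativePurity.evRelative E) ∧
      (∀ {X Y : A} (f : X ⟶ Y), PreservesColimit (parallelPair f 0) (RelativePurity.evRelative E)) ∧
      (∀ S : ShortComplex (RelativePurity.RelativePurityCategory E), S.ShortExact →
        (RelativePurity.evRelative E).essImage S.X₁ →
        (RelativePurity.evRelative E).essImage S.X₃ →
        (RelativePurity.evRelative E).essImage S.X₂) := by
  have : HasBinaryBiproducts A := hasBinaryBiproducts_of_finite_biproducts A
  let S := E.kernels (RelativePurity.fpModelEmbedding (RelativePurity.Fp A))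
  let L := S.isoModSerre.Q
  let _ := ObjectProperty.SerreClassLocalization.abelian L S
  have := ObjectProperty.SerreClassLocalization.preservesFiniteLimits L S
  have := ObjectProperty.SerreClassLocalization.preservesFiniteColimits L S
  have hq := RelativePurity.isLocalization_purityToInd E L
  refine ⟨⟨inferInstance, inferInstance⟩,
    RelativePurity.isHereditaryTorsionClassOfFiniteType_torsionClass_of_isLocalization E L, ?_⟩
  let Φ := RelativePurity.ev A ⋙ RelativePurity.purityToInd L
  have : PreservesFilteredColimitsOfSize.{w, w} Φ := inferInstance
  obtain ⟨_, _, _, hcok, hext⟩ := RelativePurity.properties_of_restriction_iso E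
    (RelativePurity.fpModelEmbedding (RelativePurity.Fp A)) L Φ
    (RelativePurity.ιCompEvCompPurityToInd L)
  -- `quotientFunctor E` and `purityToInd L` are localisations at the same morphisms, so P_E(A) is
  -- equivalent to the ind-objects of the quotient, compatibly with the functors from `A`.
  exact RelativePurity.exists_abelian_of_equivalence (Φ := Φ) (Φ' := RelativePurity.evRelative E)
    (Localization.uniq (RelativePurity.quotientFunctor E) (RelativePurity.purityToInd L)
      (RelativePurity.isoModTorsion (RelativePurity.torsionClass E)))
    (Functor.isoWhiskerLeft (RelativePurity.ev A)
      (Localization.compUniqFunctor (RelativePurity.quotientFunctor E)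
        (RelativePurity.purityToInd L)
        (RelativePurity.isoModTorsion (RelativePurity.torsionClass E)))) hcok hext
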